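/- **Theorem 2 (Label complexity).** *Setting.* Let $\mathcal Z\subset\mathbb R^d$ be a finite non-empty set of arms that spans $\mathbb R^d$, with $\|z\|\le 1$ for $z\in\mathcal Z$, and let $\theta^*\in\mathbb R^d$ satisfy $z^\top\theta^*\ne0$ for all $z\in\mathcal Z$. Let $\mu(x)=1/(1+e^{-x})$. Each query of an arm $z$ returns a fresh independent label in $\{0,1\}$ which is $1$ with probability $\mu(z^\top\theta^*)$. Let $\delta\in(0,1)$ and $\omega\in(0,1]$. Write $\|z\|_{A}^2=z^\top Az$, $\triangle(\mathcal Z)$ for the probability simplex, $H(\lambda,\theta)=\sum_{z\in\mathcal Z}\lambda_z\dot\mu(z^\top\theta)zz^\top$, and $$\gamma(d)=64\Bigl(d\log 6+\log\tfrac{2+|\mathcal Z|}{\delta}\Bigr),\quad r(\omega)=\tfrac{d(d+1)+2}{\omega},\quad \kappa_0=\min_{z\in\mathcal Z}\dot\mu(z^\top\theta^*),\quad \varepsilon_\ell=2^{-\ell+1}.$$ Minima over $\lambda\in\triangle(\mathcal Z)$ are over those $\lambda$ for which the matrix to be inverted is invertible. The minimizing designs used by the algorithm are chosen with at most $d(d+1)/2+1$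 non-zero weights. $\mathrm{ROUND}(\lambda,n)$ is the efficient apportionment of $n$ samples: it pulls $z$ exactly $k_z$ times, where $\sum_z k_z=n$, $k_z=0$ if $\lambda_z=0$, and for some common $\nu\in\mathbb R$ one has $\nu\lambda_z\le k_z\le\nu\lambda_z+1$ whenever $\lambda_z\neq 0$. The MLE for data $(z_s,y_s)_s$ is a maximizer over $\theta\in\mathbb R^d$ of $\sum_s y_s\log\mu(z_s^\top\theta)+(1-y_s)\log(1-\mu(z_s^\top\theta))$ (an arbitrary fixed choice if there is no maximizer). Ties among minimizing designs, apportionments and maximizers are broken by arbitrary rules fixed in advance. *Algorithm.* Warm-up: let $\lambda_0$ minimize $\max_{z\in\mathcal Z}\|z\|^2_{(\sum_{z'}\lambda_{z'}z'z'^\top)^{-1}}$ over $\triangle(\mathcal Z)$, let $N_0=\bigl\lceil 3(1+\omega)\kappa_0^{-1}d\,\gamma(d)\log\frac{2|\mathcal Z|(2+|\mathcal Z|)}{\delta}\bigr\rceil$, pull the arms $\mathrm{ROUND}(\lambda_0,N_0)$, and let $\hat\theta_0$ be the MLE. Put $\mathcal Z_1=\mathcal Z$. For $\ell=1,2,\dots$,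 while $\mathcal Z_\ell\ne\emptyset$: with $$f(\lambda)=\max\Bigl\{\gamma(d)\max_{z\in\mathcal Z}\|z\|^2_{H(\lambda,\hat\theta_{\ell-1})^{-1}},\ 2.4^2\varepsilon_\ell^{-2}\max_{z\in\mathcal Z_\ell}\|z\|^2_{H(\lambda,\hat\theta_{\ell-1})^{-1}}\Bigr\},$$ let $\lambda_\ell$ minimize $f$ over $\triangle(\mathcal Z)$, let $\rho(\mathcal Z_\ell)=\min_\lambda f(\lambda)$ and $N_\ell=\max\bigl\{\bigl\lceil 3(1+\omega)\rho(\mathcal Z_\ell)\log\frac{2\ell^2|\mathcal Z|(2+|\mathcal Z|)}{\delta}\bigr\rceil,\lceil r(\omega)\rceil\bigr\}$, pull the arms $\mathrm{ROUND}(\lambda_\ell,N_\ell)$, let $\hat\theta_\ell$ be the MLE for the labels of this round, and set $\mathcal Z_{\ell+1}=\mathcal Z_\ell\setminus\{z\in\mathcal Z_\ell:|z^\top\hat\theta_\ell|>\varepsilon_\ell\}$. After the loop, all the arms pulled in rounds $\ell\ge1$ are pulled once more, with multiplicity, and the MLE for the new labels is returned. *Claim.* Let $$\rho^*=\min_{\lambda\in\triangle(\mathcal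 Z)}\max_{z\in\mathcal Z}\frac{\|z\|^2_{H(\lambda,\theta^*)^{-1}}}{|z^\top\theta^*|^2},\qquad \rho_0=\min_{\lambda\in\triangle(\mathcal Z)}\max_{z\in\mathcal Z}3\gamma(d)\|z\|^2_{H(\lambda,\theta^*)^{-1}},$$ $$\Delta=\min_{z\in\mathcal Z}|z^\top\theta^*|,\qquad \ell^*=\max\{1,\lceil\log(4\Delta^{-1})\rceil\},\qquad \overline{\log}=\log\frac{2\ell^{*2}|\mathcal Z|(2+|\mathcal Z|)}{\delta}.$$ There is an absolute constant $c>0$ such that, in every such setting, with probability at least $1-\delta$ the algorithm stops and the total number of labels it has requested (warm-up, rounds and final phase together) is at most $$c(1+\omega)\ell^*\,\overline{\log}\,\rho^*+c(1+\omega)\ell^*\,\overline{\log}\,\rho_0+c(1+\omega)\kappa_0^{-1}d\,\gamma(d)\,\overline{\log}+c\,\ell^*r(\omega).$$ -/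

import Mathlib

open MeasureTheory ProbabilityTheory
open scoped Matrix

namespace PrefDesign

noncomputable section

/-- `‖z‖²_{A⁻¹} = zᵀ A⁻¹ z`; only used for positive definite `A`. -/
def invNormSq {d : ℕ} (A : Matrix (Fin d) (Fin d) ℝ) (z : Fin d → ℝ) : ℝ :=
  z ⬝ᵥ (A⁻¹ *ᵥ z)

/-- `∑_z λ_z z zᵀ`. -/
def gram {d : ℕ} (Z : Finset (Fin d → ℝ)) (l : Z → ℝ) : Matrix (Fin d) (Fin d) ℝ :=
  ∑ z : Z, l z • Matrix.vecMulVec (z : Fin d → ℝ) (z : Fin d → ℝ)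

/-- `H(λ, θ) = ∑_z λ_z μ'(zᵀθ) z zᵀ`, where `μ` is the logistic function. -/
def fisher {d : ℕ} (Z : Finset (Fin d → ℝ)) (l : Z → ℝ) (θ : Fin d → ℝ) :
    Matrix (Fin d) (Fin d) ℝ :=
  ∑ z : Z, (l z * deriv Real.sigmoid ((z : Fin d → ℝ) ⬝ᵥ θ)) •
    Matrix.vecMulVec (z : Fin d → ℝ) (z : Fin d → ℝ)

/-- The designs in the simplex `Δ(Z)` at which `H(λ, θ)` is invertible. The criteria below take the
value `+∞` at all other designs, so minimizing over `Δ(Z)` is minimizing over this set. -/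
def designs {d : ℕ} (Z : Finset (Fin d → ℝ)) (θ : Fin d → ℝ) : Set (Z → ℝ) :=
  {l | l ∈ stdSimplex ℝ Z ∧ (fisher Z l θ).PosDef}

/-- The designs in `Δ(Z)` at which `∑_z λ_z z zᵀ` is invertible. -/
def warmDesigns {d : ℕ} (Z : Finset (Fin d → ℝ)) : Set (Z → ℝ) :=
  {l | l ∈ stdSimplex ℝ Z ∧ (gram Z l).PosDef}

/-- `max_{z ∈ S} ‖z‖²_{A⁻¹}`. -/
def maxNormSq {d : ℕ} (A : Matrix (Fin d) (Fin d) ℝ) (S : Finset (Fin d → ℝ)) : ℝ :=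
  ⨆ z : S, invNormSq A z

/-- `γ(d)`, with the number of distinct sampled arms replaced by its a priori bound `|Z|`. -/
def gam {d : ℕ} (Z : Finset (Fin d → ℝ)) (δ : ℝ) : ℝ :=
  64 * (d * Real.log 6 + Real.log ((2 + Z.card) / δ))

/-- The minimal sample size `r(ω)` of the rounding procedure. -/
def rnum (d : ℕ) (ω : ℝ) : ℝ := (d * (d + 1) + 2) / ω

/-- The precision `ε_ℓ = 2^{-ℓ+1}`. -/
def eps (ℓ : ℕ) : ℝ := (2 : ℝ) ^ (1 - (ℓ : ℤ))

/-- `log (2 ℓ² |Z| (2 + |Z|) / δ)`. -/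
def logTerm {d : ℕ} (Z : Finset (Fin d → ℝ)) (δ : ℝ) (ℓ : ℕ) : ℝ :=
  Real.log (2 * (ℓ : ℝ) ^ 2 * Z.card * (2 + Z.card) / δ)

/-- `κ₀ = min_{z ∈ Z} μ'(zᵀθ)`. -/
def kappa {d : ℕ} (Z : Finset (Fin d → ℝ)) (θ : Fin d → ℝ) : ℝ :=
  ⨅ z : Z, deriv Real.sigmoid ((z : Fin d → ℝ) ⬝ᵥ θ)

/-- The criterion `f = f₁ ∨ f₂` of round `ℓ` with active set `A` and previous estimate `θ`. -/
def crit {d : ℕ} (Z : Finset (Fin d → ℝ)) (δ : ℝ) (ℓ : ℕ) (A : Finset (Fin d → ℝ))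
    (θ : Fin d → ℝ) (l : Z → ℝ) : ℝ :=
  max (gam Z δ * maxNormSq (fisher Z l θ) Z)
    (2.4 ^ 2 * (eps ℓ ^ 2)⁻¹ * maxNormSq (fisher Z l θ) A)

/-- `ρ(A) = min_λ f(A, θ, λ)`. -/
def rho {d : ℕ} (Z : Finset (Fin d → ℝ)) (δ : ℝ) (ℓ : ℕ) (A : Finset (Fin d → ℝ))
    (θ : Fin d → ℝ) : ℝ :=
  ⨅ l : designs Z θ, crit Z δ ℓ A θ l

/-- Sample size `N₀` of the warm-up. -/
def N0 {d : ℕ} (Z : Finset (Fin d → ℝ)) (δ ω : ℝ) (θstar : Fin d → ℝ) : ℕ :=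
  ⌈3 * (1 + ω) * (kappa Z θstar)⁻¹ * d * gam Z δ *
    Real.log (2 * Z.card * (2 + Z.card) / δ)⌉₊

/-- Sample size `N_ℓ` of round `ℓ ≥ 1`. -/
def N {d : ℕ} (Z : Finset (Fin d → ℝ)) (δ ω : ℝ) (ℓ : ℕ) (A : Finset (Fin d → ℝ))
    (θ : Fin d → ℝ) : ℕ :=
  max ⌈3 * (1 + ω) * rho Z δ ℓ A θ * logTerm Z δ ℓ⌉₊ ⌈rnum d ω⌉₊

/-- `l` minimizes `f` over `D` and is supported on at most `d(d+1)/2 + 1` arms. -/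
def IsOptDesign {d : ℕ} {Z : Finset (Fin d → ℝ)} (D : Set (Z → ℝ)) (f : (Z → ℝ) → ℝ)
    (l : Z → ℝ) : Prop :=
  l ∈ D ∧ IsMinOn f D l ∧ {z | l z ≠ 0}.ncard ≤ d * (d + 1) / 2 + 1

/-- `k` is an efficient apportionment of `n` samples to the weights `l` (rounding procedure of
Pukelsheim and Rieder): for a common multiplier `ν`, each `k z` with `l z ≠ 0` is `ν * l z` rounded
up, where an integer `ν * l z` may be rounded to itself or to its successor. -/
def IsEfficientRounding {d : ℕ} {Z : Finset (Fin d → ℝ)} (l : Z → ℝ) (n : ℕ) (k : Z → ℕ) : Prop :=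
  (∀ z, l z = 0 → k z = 0) ∧ ∑ z, k z = n ∧
    ∃ ν : ℝ, ∀ z, l z ≠ 0 → ν * l z ≤ k z ∧ (k z : ℝ) ≤ ν * l z + 1

/-- Log-likelihood of labelled data in the logistic model. -/
def logLik {d : ℕ} (D : Multiset ((Fin d → ℝ) × Bool)) (θ : Fin d → ℝ) : ℝ :=
  (D.map fun p => if p.2 then Real.log (Real.sigmoid (p.1 ⬝ᵥ θ))
    else Real.log (1 - Real.sigmoid (p.1 ⬝ᵥ θ))).sum

/-- `θ` is a maximum likelihood estimate for the data `D`. -/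
def IsMLE {d : ℕ} (D : Multiset ((Fin d → ℝ) × Bool)) (θ : Fin d → ℝ) : Prop :=
  ∀ θ', logLik D θ' ≤ logLik D θ

/-- The choices left open by the algorithm: maximizers of the likelihood, minimizing designs and
the ties of the rounding. -/
structure Rules {d : ℕ} (Z : Finset (Fin d → ℝ)) where
  est : Multiset ((Fin d → ℝ) × Bool) → (Fin d → ℝ)
  warm : Z → ℝ
  design : ℕ → Finset (Fin d → ℝ) → (Fin d → ℝ) → (Z → ℝ)
  round : (Z → ℝ) → ℕ → (Z → ℕ)

/-- Each rule returns an object of the required kind whenever there is one. (A maximum likelihood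
estimate need not exist, for example if the data are separable; the value returned is then
arbitrary.) -/
structure Rules.Valid {d : ℕ} {Z : Finset (Fin d → ℝ)} (R : Rules Z) (δ : ℝ) : Prop where
  est : ∀ D, (∃ θ, IsMLE D θ) → IsMLE D (R.est D)
  warm : (∃ l, IsOptDesign (warmDesigns Z) (fun l => maxNormSq (gram Z l) Z) l) →
    IsOptDesign (warmDesigns Z) (fun l => maxNormSq (gram Z l) Z) R.warm
  design : ∀ ℓ A θ, (∃ l, IsOptDesign (designs Z θ) (crit Z δ ℓ A θ) l) →
    IsOptDesign (designs Z θ) (crit Z δ ℓ A θ) (R.design ℓ A θ)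
  round : ∀ l n, (∃ k, IsEfficientRounding l n k) → IsEfficientRounding l n (R.round l n)

/-- The data obtained by pulling each arm `z` exactly `k z` times, where `y z j` is the label that
the annotator gives at the `j`-th pull of `z`. -/
def labelled {d : ℕ} {Z : Finset (Fin d → ℝ)} (k : Z → ℕ) (y : Z → ℕ → Bool) :
    Multiset ((Fin d → ℝ) × Bool) :=
  ∑ z : Z, (Multiset.range (k z)).map fun j => ((z : Fin d → ℝ), y z j)

/-- The numbers of pulls in the warm-up. -/
def warmPulls {d : ℕ} {Z : Finset (Fin d → ℝ)} (R : Rules Z) (δ ω : ℝ) (θstar : Fin d → ℝ) :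
    Z → ℕ :=
  R.round R.warm (N0 Z δ ω θstar)

/-- The numbers of pulls in round `ℓ ≥ 1` with previous estimate `s.1` and active set `s.2`. -/
def pulls {d : ℕ} {Z : Finset (Fin d → ℝ)} (R : Rules Z) (δ ω : ℝ) (ℓ : ℕ)
    (s : (Fin d → ℝ) × Finset (Fin d → ℝ)) : Z → ℕ :=
  R.round (R.design ℓ s.2 s.1) (N Z δ ω ℓ s.2 s.1)

/-- The pair `(θ̂_ℓ, Z_{ℓ+1})` after round `ℓ`; round `0` is the warm-up. Here `y ℓ z j` is the label
given at the `j`-th pull of arm `z` in round `ℓ`. -/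
def run {d : ℕ} {Z : Finset (Fin d → ℝ)} (R : Rules Z) (δ ω : ℝ) (θstar : Fin d → ℝ)
    (y : ℕ → Z → ℕ → Bool) : ℕ → (Fin d → ℝ) × Finset (Fin d → ℝ)
  | 0 => (R.est (labelled (warmPulls R δ ω θstar) (y 0)), Z)
  | ℓ + 1 =>
    let s := run R δ ω θstar y ℓ
    let θ := R.est (labelled (pulls R δ ω (ℓ + 1) s) (y (ℓ + 1)))
    (θ, s.2.filter fun z => ¬ eps (ℓ + 1) < |z ⬝ᵥ θ|)

/-- The number of labels in rounds `1, …, L`, that is, the size of the multiset `Q`. -/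
def mainLabels {d : ℕ} {Z : Finset (Fin d → ℝ)} (R : Rules Z) (δ ω : ℝ) (θstar : Fin d → ℝ)
    (y : ℕ → Z → ℕ → Bool) (L : ℕ) : ℕ :=
  ∑ ℓ ∈ Finset.range L, ∑ z, pulls R δ ω (ℓ + 1) (run R δ ω θstar y ℓ) z

/-- The while loop ends after exactly `L` rounds. -/
def EndsAfter {d : ℕ} {Z : Finset (Fin d → ℝ)} (R : Rules Z) (δ ω : ℝ) (θstar : Fin d → ℝ)
    (y : ℕ → Z → ℕ → Bool) (L : ℕ) : Prop :=
  (run R δ ω θstar y L).2 = ∅ ∧ ∀ m < L, (run R δ ω θstar y m).2 ≠ ∅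

/-- The number of all labels requested if the loop ends after `L` rounds: the warm-up, the rounds,
and the final phase, in which all the arms in `Q` are pulled once more. -/
def totalLabels {d : ℕ} {Z : Finset (Fin d → ℝ)} (R : Rules Z) (δ ω : ℝ) (θstar : Fin d → ℝ)
    (y : ℕ → Z → ℕ → Bool) (L : ℕ) : ℕ :=
  ∑ z, warmPulls R δ ω θstar z + mainLabels R δ ω θstar y L + mainLabels R δ ω θstar y L

/-- The labels are independent, and a label of arm `z` is `true` with probability `μ(zᵀθ*)`. -/
structure IsLabelTable {d : ℕ} {Z : Finset (Fin d → ℝ)} {Ω : Type*} [MeasurableSpace Ω]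
    (P : Measure Ω) (θstar : Fin d → ℝ) (Y : ℕ → Z → ℕ → Ω → Bool) : Prop where
  measurable : ∀ ℓ z j, Measurable (Y ℓ z j)
  indep : iIndepFun (fun i : ℕ × Z × ℕ => Y i.1 i.2.1 i.2.2) P
  law : ∀ ℓ z j, P {x | Y ℓ z j x = true} =
    ENNReal.ofReal (Real.sigmoid ((z : Fin d → ℝ) ⬝ᵥ θstar))

/-- `ρ* = min_λ max_z ‖z‖²_{H(λ,θ*)⁻¹} / |zᵀθ*|²`. -/
def rhoStar {d : ℕ} (Z : Finset (Fin d → ℝ)) (θstar : Fin d → ℝ) : ℝ :=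
  ⨅ l : designs Z θstar, ⨆ z : Z,
    invNormSq (fisher Z l θstar) z / |(z : Fin d → ℝ) ⬝ᵥ θstar| ^ 2

/-- `ρ₀ = min_λ max_z 3 γ(d) ‖z‖²_{H(λ,θ*)⁻¹}`. -/
def rhoZero {d : ℕ} (Z : Finset (Fin d → ℝ)) (δ : ℝ) (θstar : Fin d → ℝ) : ℝ :=
  ⨅ l : designs Z θstar, ⨆ z : Z, 3 * gam Z δ * invNormSq (fisher Z l θstar) z

/-- `Δ = min_z |zᵀθ*|`. -/
def gap {d : ℕ} (Z : Finset (Fin d → ℝ)) (θstar : Fin d → ℝ) : ℝ :=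
  ⨅ z : Z, |(z : Fin d → ℝ) ⬝ᵥ θstar|

/-- `ℓ* = max {1, ⌈log (4 Δ⁻¹)⌉}`. -/
def lstar {d : ℕ} (Z : Finset (Fin d → ℝ)) (θstar : Fin d → ℝ) : ℕ :=
  max 1 ⌈Real.log (4 * (gap Z θstar)⁻¹)⌉₊

end

end PrefDesign

namespace PrefDesign

/-! ### The logistic function: local linearity and slow variation of its slope. -/

section Sigmoid

/-! Fix the pull counts of one round, let H be their Fisher information at θ*, and measure arms by
‖z‖² = zᵀH⁻¹z. If all these norms are at most 1/(80dT) (`Informative`), a Bernstein bound in each of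
the directions H⁻¹z shows that the score at θ* is small there, except with probability 2|Z|e^{-T}
(`measure_not_goodNoise_le`). The trace identity ∑ w_z‖z‖² = d turns these finitely many bounds into
one for all directions. Hence the score points inwards on an ellipsoid around θ* so small that zᵀθ
moves by at most 1/2 for every arm. By concavity along rays a maximum likelihood estimate exists and
lies inside, and a bootstrap on the linearized score equation gives the error 4√(T‖z‖²), without a
factor d (`IsMLE.error_le`).

The pull counts of a round are a function of the labels of earlier rounds, hence independent of the
labels of this round, and they take countably many values; so the bound for fixed counts holds for
the adaptive ones (`measure_adaptive_le`). The failure probabilities of the rounds sum to at most δ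
(`measure_goodNoise_ge`).

On the remaining event the argument is deterministic. The warm-up is informative because an optimal
design has norms at most d (`exists_design_maxNormSq_le`). An error of at most 1/2 changes each
slope μ'(zᵀθ) by a factor of at most 2, so a design chosen for the estimate also serves θ*, and each
round makes the next one informative (`round_informative`, `run_error`). Active arms have error at
most 2ε_ℓ, so survivors of round ℓ satisfy |zᵀθ*| ≤ 3ε_ℓ; this limits the number of rounds to 4ℓ*
(`exists_endsAfter`). It also makes an equal mixture of designs for ρ* and ρ₀ a good competitor in
each round, whose criterion is therefore at most 830ρ* + 2ρ₀ (`rho_le`). Summing over the rounds,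
doubling for the final phase and adding the warm-up gives the bound (`totalLabels_le`). -/

lemma deriv_sigmoid_pos (t : ℝ) : 0 < deriv Real.sigmoid t := by
  rw [Real.deriv_sigmoid]
  exact mul_pos (Real.sigmoid_pos t) (sub_pos.2 (Real.sigmoid_lt_one t))

lemma deriv_sigmoid_le_one (t : ℝ) : deriv Real.sigmoid t ≤ 1 := by
  rw [Real.deriv_sigmoid]
  have h1 := Real.sigmoid_pos t
  have h2 := Real.sigmoid_lt_one t
  nlinarith

lemma deriv_sigmoid_eq (t : ℝ) :
    deriv Real.sigmoid t = Real.exp (-t) / (1 + Real.exp (-t)) ^ 2 := by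
  have h := Real.exp_pos (-t)
  rw [Real.deriv_sigmoid]
  simp only [Real.sigmoid_def]
  field_simp
  ring

/-- The slope of the logistic function is close to its derivative, in relative terms. -/
lemma abs_sigmoid_add_sub_le {t x : ℝ} (hx : |x| ≤ 1) :
    |Real.sigmoid (t + x) - Real.sigmoid t - deriv Real.sigmoid t * x| ≤
      deriv Real.sigmoid t * x ^ 2 := by
  set p := Real.exp (-t) with hp
  set q := Real.exp (-x) with hq
  have hp0 : 0 < p := Real.exp_pos _
  have hq0 : 0 < q := Real.exp_pos _
  have e1 : Real.exp (-(t + x)) = p * q := by rw [hp, hq, ← Real.exp_add]; congr 1; ring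
  have hqx : Real.exp x = q⁻¹ := by rw [hq, Real.exp_neg, inv_inv]
  have b1 : |q - 1 + x| ≤ x ^ 2 := by
    have := Real.abs_exp_sub_one_sub_id_le (x := -x) (by simpa using hx)
    simpa [hq] using this
  have b2 : |q⁻¹ - 1 - x| ≤ x ^ 2 := by
    rw [← hqx]; exact Real.abs_exp_sub_one_sub_id_le hx
  have hid : Real.sigmoid (t + x) - Real.sigmoid t - deriv Real.sigmoid t * x =
      deriv Real.sigmoid t * ((-(q - 1 + x) + p * q * (q⁻¹ - 1 - x)) / (1 + p * q)) := by
    rw [deriv_sigmoid_eq]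
    simp only [Real.sigmoid_def]
    rw [e1, ← hp]
    field_simp
    ring
  rw [hid, abs_mul, abs_of_pos (deriv_sigmoid_pos t)]
  refine mul_le_mul_of_nonneg_left ?_ (deriv_sigmoid_pos t).le
  have hpq : 0 < p * q := mul_pos hp0 hq0
  rw [abs_div, abs_of_pos (by positivity : 0 < 1 + p * q), div_le_iff₀ (by positivity)]
  calc |-(q - 1 + x) + p * q * (q⁻¹ - 1 - x)|
      ≤ |-(q - 1 + x)| + |p * q * (q⁻¹ - 1 - x)| := abs_add_le _ _
    _ = |q - 1 + x| + p * q * |q⁻¹ - 1 - x| := by rw [abs_neg, abs_mul, abs_of_pos hpq]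
    _ ≤ x ^ 2 + p * q * x ^ 2 := by gcongr
    _ = x ^ 2 * (1 + p * q) := by ring

/-- Self-concordance of the logistic loss, |μ''| ≤ μ', in integrated form. With p = e^{-t} and q =
e^{-x} it becomes an inequality between polynomials in p and q, split by the sign of x. -/
lemma deriv_sigmoid_le_exp_mul (t x : ℝ) :
    deriv Real.sigmoid t ≤ Real.exp |x| * deriv Real.sigmoid (t + x) := by
  set p := Real.exp (-t) with hp
  set q := Real.exp (-x) with hq
  have hp0 : 0 < p := Real.exp_pos _
  have hq0 : 0 < q := Real.exp_pos _
  have e1 : Real.exp (-(t + x)) = p * q := by rw [hp, hq, ← Real.exp_add]; congr 1; ring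
  rw [deriv_sigmoid_eq, deriv_sigmoid_eq, e1, ← hp, ← mul_div_assoc,
    div_le_div_iff₀ (by positivity) (by positivity)]
  rcases le_total 0 x with hx | hx
  · have hqx : Real.exp |x| * q = 1 := by
      rw [abs_of_nonneg hx, hq, ← Real.exp_add]; simp
    have hq1 : q ≤ 1 := by rw [hq]; exact Real.exp_le_one_iff.2 (by linarith)
    calc p * (1 + p * q) ^ 2 ≤ p * (1 + p * 1) ^ 2 := by gcongr
      _ = Real.exp |x| * q * p * (1 + p) ^ 2 := by rw [hqx]; ring
      _ = _ := by ring
  · have hqx : Real.exp |x| = q := by rw [abs_of_nonpos hx]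
    have hq1 : 1 ≤ q := by rw [hq]; exact Real.one_le_exp (by linarith)
    rw [hqx]
    calc p * (1 + p * q) ^ 2 ≤ p * (q + p * q) ^ 2 := by gcongr
      _ = _ := by ring

lemma exp_abs_le_two {x : ℝ} (hx : |x| ≤ 1 / 2) : Real.exp |x| ≤ 2 := by
  have h := Real.abs_exp_sub_one_sub_id_le (x := |x|) (by rw [abs_abs]; linarith)
  have h1 := (abs_le.1 h).2
  have h2 := abs_nonneg x
  nlinarith

/-- This exchanges the estimate and the true parameter inside the Fisher information at the cost of
a factor 2. -/
lemma deriv_sigmoid_le_two_mul {s t : ℝ} (h : |s - t| ≤ 1 / 2) :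
    deriv Real.sigmoid t ≤ 2 * deriv Real.sigmoid s := by
  have h1 := deriv_sigmoid_le_exp_mul t (s - t)
  rw [add_sub_cancel] at h1
  exact h1.trans (mul_le_mul_of_nonneg_right (exp_abs_le_two h) (deriv_sigmoid_pos s).le)

end Sigmoid

/-! ### Weighted Gram matrices and the norms of their inverses. -/

section QuadraticForm

variable {d : ℕ} {Z : Finset (Fin d → ℝ)}

lemma fisher_eq_gram (l : Z → ℝ) (θ : Fin d → ℝ) :
    fisher Z l θ = gram Z (fun z => l z * deriv Real.sigmoid ((z : Fin d → ℝ) ⬝ᵥ θ)) := rfl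

lemma gram_mulVec (w : Z → ℝ) (x : Fin d → ℝ) :
    gram Z w *ᵥ x = ∑ z : Z, (w z * ((z : Fin d → ℝ) ⬝ᵥ x)) • (z : Fin d → ℝ) := by
  simp only [gram, Matrix.sum_mulVec, Matrix.smul_mulVec, Matrix.vecMulVec_mulVec]
  refine Finset.sum_congr rfl fun z _ => ?_
  ext i
  simp
  ring

lemma dotProduct_gram_mulVec (w : Z → ℝ) (x y : Fin d → ℝ) :
    x ⬝ᵥ (gram Z w *ᵥ y) =
      ∑ z : Z, w z * ((z : Fin d → ℝ) ⬝ᵥ x) * ((z : Fin d → ℝ) ⬝ᵥ y) := by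
  rw [gram_mulVec, dotProduct_sum]
  refine Finset.sum_congr rfl fun z _ => ?_
  rw [dotProduct_smul, dotProduct_comm x, smul_eq_mul]
  ring

lemma gram_isHermitian (w : Z → ℝ) : (gram Z w).IsHermitian := by
  rw [Matrix.IsHermitian, Matrix.conjTranspose_eq_transpose_of_trivial]
  ext i j
  simp [gram, Matrix.sum_apply, Matrix.vecMulVec_apply, mul_comm]

lemma gram_posDef_iff {w : Z → ℝ} :
    (gram Z w).PosDef ↔ ∀ x, x ≠ 0 → 0 < ∑ z : Z, w z * ((z : Fin d → ℝ) ⬝ᵥ x) ^ 2 := by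
  have key : ∀ x : Fin d → ℝ, x ⬝ᵥ (gram Z w *ᵥ x) =
      ∑ z : Z, w z * ((z : Fin d → ℝ) ⬝ᵥ x) ^ 2 := fun x => by
    rw [dotProduct_gram_mulVec]
    exact Finset.sum_congr rfl fun z _ => by ring
  constructor
  · intro h x hx
    have := h.dotProduct_mulVec_pos hx
    rwa [star_trivial, key] at this
  · intro h
    refine Matrix.PosDef.of_dotProduct_mulVec_pos (gram_isHermitian w) fun x hx => ?_
    rw [star_trivial, key]
    exact h x hx

lemma posDef_mulVec_inv_mulVec {A : Matrix (Fin d) (Fin d) ℝ} (hA : A.PosDef) (x : Fin d → ℝ) :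
    A *ᵥ (A⁻¹ *ᵥ x) = x := by
  rw [Matrix.mulVec_mulVec, Matrix.mul_nonsing_inv _ ((Matrix.isUnit_iff_isUnit_det A).1 hA.isUnit),
    Matrix.one_mulVec]

lemma invNormSq_nonneg {A : Matrix (Fin d) (Fin d) ℝ} (hA : A.PosDef) (z : Fin d → ℝ) :
    0 ≤ invNormSq A z := by
  have := hA.inv.posSemidef.dotProduct_mulVec_nonneg z
  rwa [star_trivial] at this

lemma invNormSq_pos {A : Matrix (Fin d) (Fin d) ℝ} (hA : A.PosDef) {z : Fin d → ℝ} (hz : z ≠ 0) :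
    0 < invNormSq A z := by
  have := hA.inv.dotProduct_mulVec_pos hz
  rwa [star_trivial] at this

lemma weighted_cauchy_schwarz {w : Z → ℝ} (hw : ∀ z, 0 ≤ w z) (f g : Z → ℝ) :
    (∑ z, w z * f z * g z) ^ 2 ≤ (∑ z, w z * f z ^ 2) * ∑ z, w z * g z ^ 2 := by
  have h := Finset.sum_mul_sq_le_sq_mul_sq Finset.univ (fun z => √(w z) * f z)
    (fun z => √(w z) * g z)
  have e : ∀ a b : Z → ℝ, ∀ z, √(w z) * a z * (√(w z) * b z) = w z * a z * b z := fun a b z => by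
    calc √(w z) * a z * (√(w z) * b z) = √(w z) * √(w z) * a z * b z := by ring
      _ = _ := by rw [Real.mul_self_sqrt (hw z)]
  simp only [mul_pow, Real.sq_sqrt (hw _)] at h
  simpa only [e] using h

/-- Writing v = A(A⁻¹v) expands vᵀx over the arms. All later estimates with inverse matrices reduce
to weighted sums through this expansion. -/
lemma dotProduct_eq_sum {w : Z → ℝ} (hA : (gram Z w).PosDef) (v x : Fin d → ℝ) :
    v ⬝ᵥ x = ∑ z : Z, w z * ((z : Fin d → ℝ) ⬝ᵥ ((gram Z w)⁻¹ *ᵥ v)) * ((z : Fin d → ℝ) ⬝ᵥ x) := by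
  conv_lhs => rw [← posDef_mulVec_inv_mulVec hA v, dotProduct_comm, dotProduct_gram_mulVec]
  exact Finset.sum_congr rfl fun z _ => by ring

lemma invNormSq_eq_sum {w : Z → ℝ} (hA : (gram Z w).PosDef) (v : Fin d → ℝ) :
    invNormSq (gram Z w) v = ∑ z : Z, w z * ((z : Fin d → ℝ) ⬝ᵥ ((gram Z w)⁻¹ *ᵥ v)) ^ 2 := by
  rw [invNormSq, dotProduct_eq_sum hA]
  exact Finset.sum_congr rfl fun z _ => by ring

lemma sq_dotProduct_le {w : Z → ℝ} (hw : ∀ z, 0 ≤ w z) (hA : (gram Z w).PosDef)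
    (v x : Fin d → ℝ) :
    (v ⬝ᵥ x) ^ 2 ≤ invNormSq (gram Z w) v * ∑ z : Z, w z * ((z : Fin d → ℝ) ⬝ᵥ x) ^ 2 := by
  rw [dotProduct_eq_sum hA, invNormSq_eq_sum hA]
  exact weighted_cauchy_schwarz hw _ _

/-- Converse of `sq_dotProduct_le`: at x = A⁻¹v the hypothesis reads q² ≤ bq for q = vᵀA⁻¹v.
Comparing inverses thus needs only a comparison of weights. -/
lemma invNormSq_le_of_forall {w : Z → ℝ} (hA : (gram Z w).PosDef)
    {v : Fin d → ℝ} {b : ℝ} (hb : 0 ≤ b)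
    (h : ∀ x, (v ⬝ᵥ x) ^ 2 ≤ b * ∑ z : Z, w z * ((z : Fin d → ℝ) ⬝ᵥ x) ^ 2) :
    invNormSq (gram Z w) v ≤ b := by
  have h1 := h ((gram Z w)⁻¹ *ᵥ v)
  rw [← invNormSq_eq_sum hA] at h1
  change invNormSq (gram Z w) v ^ 2 ≤ _ at h1
  by_contra! hlt
  nlinarith

lemma gram_posDef_of_le {w w' : Z → ℝ} {c : ℝ} (hc : 0 < c) (h : ∀ z, c * w' z ≤ w z)
    (hA : (gram Z w').PosDef) : (gram Z w).PosDef := by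
  rw [gram_posDef_iff] at hA ⊢
  intro x hx
  refine (mul_pos hc (hA x hx)).trans_le ?_
  rw [Finset.mul_sum]
  refine Finset.sum_le_sum fun z _ => ?_
  rw [← mul_assoc]
  exact mul_le_mul_of_nonneg_right (h z) (sq_nonneg _)

lemma invNormSq_le_of_le {w w' : Z → ℝ} {c : ℝ} (hc : 0 < c) (hw' : ∀ z, 0 ≤ w' z)
    (h : ∀ z, c * w' z ≤ w z) (hA : (gram Z w').PosDef) (v : Fin d → ℝ) :
    invNormSq (gram Z w) v ≤ c⁻¹ * invNormSq (gram Z w') v := by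
  have hp := invNormSq_nonneg hA v
  refine invNormSq_le_of_forall (gram_posDef_of_le hc h hA) (by positivity) fun x => ?_
  refine (sq_dotProduct_le hw' hA v x).trans ?_
  rw [mul_comm c⁻¹, mul_assoc]
  refine mul_le_mul_of_nonneg_left ?_ hp
  rw [Finset.mul_sum]
  refine Finset.sum_le_sum fun z _ => ?_
  rw [← mul_assoc]
  refine mul_le_mul_of_nonneg_right ?_ (sq_nonneg _)
  rw [inv_mul_eq_div, le_div_iff₀ hc, mul_comm]
  exact h z

/-- Both sides are the trace of A⁻¹A. -/
lemma sum_mul_invNormSq {w : Z → ℝ} (hA : (gram Z w).PosDef) :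
    ∑ z : Z, w z * invNormSq (gram Z w) z = d := by
  have h1 : ((gram Z w)⁻¹ * gram Z w).trace = d := by
    rw [Matrix.nonsing_inv_mul _ ((Matrix.isUnit_iff_isUnit_det _).1 hA.isUnit)]
    simp
  rw [← h1]
  conv_rhs => enter [1, 2]; unfold gram
  rw [Matrix.mul_sum, Matrix.trace_sum]
  refine Finset.sum_congr rfl fun z _ => ?_
  rw [Matrix.mul_smul, Matrix.trace_smul, Matrix.mul_vecMulVec, Matrix.trace_vecMulVec,
    dotProduct_comm, smul_eq_mul, invNormSq]

end QuadraticForm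

/-! ### Derivative of the log-likelihood and its monotonicity along rays. -/

section Likelihood

variable {d : ℕ} {Z : Finset (Fin d → ℝ)}

/-- The gradient of the log-likelihood. -/
noncomputable def score (D : Multiset ((Fin d → ℝ) × Bool)) (θ : Fin d → ℝ) : Fin d → ℝ :=
  (D.map fun p => ((if p.2 then (1 : ℝ) else 0) - Real.sigmoid (p.1 ⬝ᵥ θ)) • p.1).sum

lemma score_dotProduct (D : Multiset ((Fin d → ℝ) × Bool)) (θ v : Fin d → ℝ) :
    score D θ ⬝ᵥ v = (D.map fun p =>
      ((if p.2 then (1 : ℝ) else 0) - Real.sigmoid (p.1 ⬝ᵥ θ)) * (p.1 ⬝ᵥ v)).sum := by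
  induction D using Multiset.induction_on with
  | empty => simp [score]
  | cons a D ih =>
    simp only [score, Multiset.map_cons, Multiset.sum_cons, add_dotProduct, smul_dotProduct,
      smul_eq_mul] at ih ⊢
    rw [ih]

lemma sum_map_labelled (k : Z → ℕ) (y : Z → ℕ → Bool) (f : (Fin d → ℝ) × Bool → ℝ) :
    ((labelled k y).map f).sum =
      ∑ z : Z, ∑ j ∈ Finset.range (k z), f ((z : Fin d → ℝ), y z j) := by
  unfold labelled
  rw [← Multiset.coe_mapAddMonoidHom, map_sum, ← Multiset.coe_sumAddMonoidHom, map_sum]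
  refine Finset.sum_congr rfl fun z _ => ?_
  simp [Finset.sum, Multiset.map_map]

lemma score_labelled_sub (k : Z → ℕ) (y : Z → ℕ → Bool) (θ θ' v : Fin d → ℝ) :
    score (labelled k y) θ ⬝ᵥ v - score (labelled k y) θ' ⬝ᵥ v =
      ∑ z : Z, (k z : ℝ) * (Real.sigmoid ((z : Fin d → ℝ) ⬝ᵥ θ') -
        Real.sigmoid ((z : Fin d → ℝ) ⬝ᵥ θ)) * ((z : Fin d → ℝ) ⬝ᵥ v) := by
  rw [score_dotProduct, score_dotProduct, sum_map_labelled, sum_map_labelled,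
    ← Finset.sum_sub_distrib]
  refine Finset.sum_congr rfl fun z _ => ?_
  rw [← Finset.sum_sub_distrib]
  simp only [← sub_mul, sub_sub_sub_cancel_left]
  simp [mul_assoc]

lemma hasDerivAt_logLik_term (x θ v : Fin d → ℝ) (b : Bool) (s : ℝ) :
    HasDerivAt (fun s : ℝ => if b then Real.log (Real.sigmoid (x ⬝ᵥ (θ + s • v)))
      else Real.log (1 - Real.sigmoid (x ⬝ᵥ (θ + s • v))))
      (((if b then (1 : ℝ) else 0) - Real.sigmoid (x ⬝ᵥ (θ + s • v))) * (x ⬝ᵥ v)) s := by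
  have h1 : HasDerivAt (fun s : ℝ => x ⬝ᵥ (θ + s • v)) (x ⬝ᵥ v) s := by
    simp only [dotProduct_add, dotProduct_smul, smul_eq_mul]
    simpa using ((hasDerivAt_id s).mul_const (x ⬝ᵥ v)).const_add (x ⬝ᵥ θ)
  have h2 := (Real.hasDerivAt_sigmoid (x ⬝ᵥ (θ + s • v))).comp s h1
  have p1 := Real.sigmoid_pos (x ⬝ᵥ (θ + s • v))
  have p2 := sub_pos.2 (Real.sigmoid_lt_one (x ⬝ᵥ (θ + s • v)))
  cases b
  · have h3 := (h2.const_sub 1).log p2.ne'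
    simp only [Function.comp_apply] at h3
    simp only [Bool.false_eq_true, if_false]
    convert h3 using 1
    field_simp
    ring
  · have h3 := h2.log p1.ne'
    simp only [Function.comp_apply] at h3
    simp only [if_true]
    convert h3 using 1
    field_simp

lemma hasDerivAt_logLik (D : Multiset ((Fin d → ℝ) × Bool)) (θ v : Fin d → ℝ) (s : ℝ) :
    HasDerivAt (fun s : ℝ => logLik D (θ + s • v)) (score D (θ + s • v) ⬝ᵥ v) s := by
  rw [score_dotProduct]
  unfold logLik
  induction D using Multiset.induction_on with
  | empty => simpa using hasDerivAt_const s (0 : ℝ)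
  | cons a D ih =>
    simp only [Multiset.map_cons, Multiset.sum_cons]
    exact (hasDerivAt_logLik_term a.1 θ v a.2 s).add ih

lemma continuous_logLik (D : Multiset ((Fin d → ℝ) × Bool)) : Continuous (logLik D) := by
  unfold logLik
  induction D using Multiset.induction_on with
  | empty => simpa using continuous_const
  | cons a D ih =>
    simp only [Multiset.map_cons, Multiset.sum_cons]
    refine Continuous.add ?_ ih
    have h1 : Continuous fun θ : Fin d → ℝ => Real.sigmoid (a.1 ⬝ᵥ θ) :=
      continuous_sigmoid.comp (continuous_const.dotProduct continuous_id)
    split_ifs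
    · exact h1.log fun θ => (Real.sigmoid_pos _).ne'
    · exact (continuous_const.sub h1).log fun θ => (sub_pos.2 (Real.sigmoid_lt_one _)).ne'

lemma IsMLE.score_eq_zero {D : Multiset ((Fin d → ℝ) × Bool)} {θ : Fin d → ℝ} (h : IsMLE D θ)
    (v : Fin d → ℝ) : score D θ ⬝ᵥ v = 0 := by
  have h1 := hasDerivAt_logLik D θ v 0
  have h2 : IsLocalMax (fun s : ℝ => logLik D (θ + s • v)) 0 :=
    Filter.Eventually.of_forall fun s => by simpa using h (θ + s • v)
  simpa using h2.hasDerivAt_eq_zero h1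

/-- The score in direction `u` decreases along the ray from `θ` in direction `u`. -/
lemma score_ray_le (k : Z → ℕ) (y : Z → ℕ → Bool) (θ u : Fin d → ℝ) {s s' : ℝ} (hs : s ≤ s') :
    score (labelled k y) (θ + s' • u) ⬝ᵥ u ≤ score (labelled k y) (θ + s • u) ⬝ᵥ u := by
  rw [← sub_nonpos, score_labelled_sub]
  refine Finset.sum_nonpos fun z _ => ?_
  rw [mul_assoc]
  refine mul_nonpos_of_nonneg_of_nonpos (Nat.cast_nonneg _) ?_
  simp only [dotProduct_add, dotProduct_smul, smul_eq_mul]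
  rcases le_total 0 ((z : Fin d → ℝ) ⬝ᵥ u) with h | h
  · exact mul_nonpos_of_nonpos_of_nonneg (sub_nonpos.2 (Real.sigmoid_le (by gcongr))) h
  · refine mul_nonpos_of_nonneg_of_nonpos (sub_nonneg.2 (Real.sigmoid_le ?_)) h
    have := mul_le_mul_of_nonpos_right hs h
    linarith

end Likelihood

/-! ### Existence and accuracy of the maximum likelihood estimate, given small noise. -/

section MaximumLikelihood

variable {d : ℕ} {Z : Finset (Fin d → ℝ)} {k : Z → ℕ} {y : Z → ℕ → Bool} {θs : Fin d → ℝ} {T : ℝ}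

/-- `‖u‖²_H` for the Fisher information `H` of `k z` pulls of each arm `z`. -/
noncomputable def fisherSq (k : Z → ℕ) (θs u : Fin d → ℝ) : ℝ :=
  ∑ z : Z, (k z : ℝ) * deriv Real.sigmoid ((z : Fin d → ℝ) ⬝ᵥ θs) * ((z : Fin d → ℝ) ⬝ᵥ u) ^ 2

lemma fisher_weight_nonneg (k : Z → ℕ) (θs : Fin d → ℝ) (z : Z) :
    0 ≤ (k z : ℝ) * deriv Real.sigmoid ((z : Fin d → ℝ) ⬝ᵥ θs) :=
  mul_nonneg (Nat.cast_nonneg _) (deriv_sigmoid_pos _).le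

lemma fisherSq_nonneg (k : Z → ℕ) (θs u : Fin d → ℝ) : 0 ≤ fisherSq k θs u :=
  Finset.sum_nonneg fun z _ => mul_nonneg (fisher_weight_nonneg k θs z) (sq_nonneg _)

lemma fisherSq_smul (k : Z → ℕ) (θs u : Fin d → ℝ) (s : ℝ) :
    fisherSq k θs (s • u) = s ^ 2 * fisherSq k θs u := by
  unfold fisherSq
  rw [Finset.mul_sum]
  refine Finset.sum_congr rfl fun z _ => ?_
  rw [dotProduct_smul, smul_eq_mul]
  ring

lemma sq_dotProduct_le_fisherSq (hA : (fisher Z (fun z => (k z : ℝ)) θs).PosDef)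
    (v u : Fin d → ℝ) :
    (v ⬝ᵥ u) ^ 2 ≤ invNormSq (fisher Z (fun z => (k z : ℝ)) θs) v * fisherSq k θs u :=
  sq_dotProduct_le (fisher_weight_nonneg k θs) hA v u

lemma dotProduct_inv_mulVec_comm {A : Matrix (Fin d) (Fin d) ℝ} (hA : A.PosDef)
    (x z : Fin d → ℝ) : x ⬝ᵥ (A⁻¹ *ᵥ z) = z ⬝ᵥ (A⁻¹ *ᵥ x) := by
  have h : (A⁻¹)ᵀ = A⁻¹ := by
    have := hA.inv.isHermitian
    rwa [Matrix.IsHermitian, Matrix.conjTranspose_eq_transpose_of_trivial] at this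
  rw [Matrix.dotProduct_mulVec, ← Matrix.mulVec_transpose, h, dotProduct_comm]

/-- The noise of the labels `y` is small, at level `T`, in the direction of every arm. -/
def GoodNoise (θs : Fin d → ℝ) (T : ℝ) (k : Z → ℕ) (D : Multiset ((Fin d → ℝ) × Bool)) : Prop :=
  ∀ z ∈ Z, (score D θs ⬝ᵥ ((fisher Z (fun z => (k z : ℝ)) θs)⁻¹ *ᵥ z)) ^ 2 ≤
    4 * T * invNormSq (fisher Z (fun z => (k z : ℝ)) θs) z

/-- The pulls `k` are informative, at level `T`, about every arm. -/
def Informative (θs : Fin d → ℝ) (T : ℝ) (k : Z → ℕ) : Prop :=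
  (fisher Z (fun z => (k z : ℝ)) θs).PosDef ∧
    ∀ z ∈ Z, invNormSq (fisher Z (fun z => (k z : ℝ)) θs) z ≤ 1 / (80 * d * T)

lemma GoodNoise.sq_score_dotProduct_le (hA : (fisher Z (fun z => (k z : ℝ)) θs).PosDef)
    {D : Multiset ((Fin d → ℝ) × Bool)} (hE : GoodNoise θs T k D) (u : Fin d → ℝ) :
    (score D θs ⬝ᵥ u) ^ 2 ≤ 4 * d * T * fisherSq k θs u := by
  refine (sq_dotProduct_le_fisherSq hA _ u).trans
    (mul_le_mul_of_nonneg_right ?_ (fisherSq_nonneg k θs u))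
  -- The squared dual norm of the score is the weighted sum over the arms of its squared products
  -- with H⁻¹z. `GoodNoise` bounds each term, and the trace identity sums the bounds to 4dT, so no
  -- covering of the sphere is needed.
  rw [fisher_eq_gram, invNormSq_eq_sum hA]
  calc _ ≤ ∑ z : Z, (k z : ℝ) * deriv Real.sigmoid ((z : Fin d → ℝ) ⬝ᵥ θs) *
        (4 * T * invNormSq (fisher Z (fun z => (k z : ℝ)) θs) z) := by
        refine Finset.sum_le_sum fun z _ =>
          mul_le_mul_of_nonneg_left ?_ (fisher_weight_nonneg k θs z)
        have h := hE z z.2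
        rwa [dotProduct_inv_mulVec_comm hA] at h
    _ = 4 * T * ∑ z : Z, (k z : ℝ) * deriv Real.sigmoid ((z : Fin d → ℝ) ⬝ᵥ θs) *
        invNormSq (fisher Z (fun z => (k z : ℝ)) θs) z := by
        rw [Finset.mul_sum]
        exact Finset.sum_congr rfl fun z _ => by ring
    _ = 4 * T * d := by rw [← sum_mul_invNormSq hA]; rfl
    _ = _ := by ring

/-- Cauchy–Schwarz with 20dT / (80dT) = (1/2)²: on the ellipsoid of squared radius 20dT every arm
stays in the range where μ is nearly linear. -/
lemma Informative.abs_dotProduct_le (hd : 0 < d) (hT : 0 < T) (hk : Informative θs T k)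
    {u : Fin d → ℝ} (hu : fisherSq k θs u ≤ 20 * d * T) {z : Fin d → ℝ} (hz : z ∈ Z) :
    |z ⬝ᵥ u| ≤ 1 / 2 := by
  have hd' : (0 : ℝ) < d := Nat.cast_pos.2 hd
  refine abs_le_of_sq_le_sq ?_ (by norm_num)
  calc (z ⬝ᵥ u) ^ 2 ≤ _ := sq_dotProduct_le_fisherSq hk.1 z u
    _ ≤ 1 / (80 * d * T) * (20 * d * T) :=
        mul_le_mul (hk.2 z hz) hu (fisherSq_nonneg k θs u) (by positivity)
    _ = (1 / 2) ^ 2 := by field_simp; norm_num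

/-- Strong concavity near the true parameter: the relative error of linearizing μ is at most |zᵀu| ≤
1/2, so half of the quadratic form survives. -/
lemma half_fisherSq_le {u : Fin d → ℝ} (hu : ∀ z ∈ Z, |z ⬝ᵥ u| ≤ 1 / 2) :
    fisherSq k θs u / 2 ≤ ∑ z : Z, (k z : ℝ) * (Real.sigmoid ((z : Fin d → ℝ) ⬝ᵥ (θs + u)) -
      Real.sigmoid ((z : Fin d → ℝ) ⬝ᵥ θs)) * ((z : Fin d → ℝ) ⬝ᵥ u) := by
  unfold fisherSq
  rw [Finset.sum_div]
  refine Finset.sum_le_sum fun z _ => ?_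
  rw [dotProduct_add]
  have h0 := hu z z.2
  set x := (z : Fin d → ℝ) ⬝ᵥ u
  set t := (z : Fin d → ℝ) ⬝ᵥ θs
  have h1 := abs_sigmoid_add_sub_le (t := t) (x := x) (by linarith)
  have h2 := deriv_sigmoid_pos t
  set m := deriv Real.sigmoid t
  have h3 : |(Real.sigmoid (t + x) - Real.sigmoid t - m * x) * x| ≤ m * x ^ 2 * (1 / 2) := by
    rw [abs_mul]
    exact mul_le_mul h1 h0 (abs_nonneg _) (by positivity)
  have h4 := (abs_le.1 h3).1
  have h5 : m * x ^ 2 / 2 ≤ (Real.sigmoid (t + x) - Real.sigmoid t) * x := by nlinarith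
  calc (k z : ℝ) * m * x ^ 2 / 2 = k z * (m * x ^ 2 / 2) := by ring
    _ ≤ k z * ((Real.sigmoid (t + x) - Real.sigmoid t) * x) := by gcongr
    _ = _ := by ring

lemma score_add_dotProduct (k : Z → ℕ) (y : Z → ℕ → Bool) (θs u v : Fin d → ℝ) :
    score (labelled k y) (θs + u) ⬝ᵥ v = score (labelled k y) θs ⬝ᵥ v -
      ∑ z : Z, (k z : ℝ) * (Real.sigmoid ((z : Fin d → ℝ) ⬝ᵥ (θs + u)) -
      Real.sigmoid ((z : Fin d → ℝ) ⬝ᵥ θs)) * ((z : Fin d → ℝ) ⬝ᵥ v) := by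
  rw [← score_labelled_sub k y θs (θs + u) v]
  ring

/-- The score points inwards on a sphere around the true parameter. -/
lemma score_dotProduct_neg (hd : 0 < d) (hT : 0 < T) (hk : Informative θs T k)
    (hE : GoodNoise θs T k (labelled k y)) {u : Fin d → ℝ} (hu : fisherSq k θs u = 20 * d * T) :
    score (labelled k y) (θs + u) ⬝ᵥ u < 0 := by
  have hd' : (0 : ℝ) < d := Nat.cast_pos.2 hd
  have h1 := half_fisherSq_le (k := k) (θs := θs) fun z hz => hk.abs_dotProduct_le hd hT hu.le hz
  have h2 := hE.sq_score_dotProduct_le hk.1 u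
  rw [hu] at h1 h2
  rw [score_add_dotProduct]
  -- The noise term squared is at most 4dT · 20dT = 80(dT)² < (10dT)², while the curvature
  -- contributes 20dT / 2.
  have h3 : score (labelled k y) θs ⬝ᵥ u < 10 * d * T := by
    refine lt_of_pow_lt_pow_left₀ 2 (by positivity) (h2.trans_lt ?_)
    have : (0 : ℝ) < (d * T) ^ 2 := by positivity
    nlinarith
  linarith

/-- The central projection of an outer point to the sphere. -/
lemma exists_eq_smul_of_le (hd : 0 < d) (hT : 0 < T) {u : Fin d → ℝ}
    (hu : 20 * d * T ≤ fisherSq k θs u) :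
    ∃ (s : ℝ) (u₀ : Fin d → ℝ), 1 ≤ s ∧ fisherSq k θs u₀ = 20 * d * T ∧ u = s • u₀ := by
  have hd' : (0 : ℝ) < d := Nat.cast_pos.2 hd
  have hr : 0 < 20 * d * T := by positivity
  have hs : 1 ≤ fisherSq k θs u / (20 * d * T) := (one_le_div hr).2 hu
  have hs1 : 1 ≤ √(fisherSq k θs u / (20 * d * T)) := Real.one_le_sqrt.2 hs
  refine ⟨√(fisherSq k θs u / (20 * d * T)), (√(fisherSq k θs u / (20 * d * T)))⁻¹ • u, hs1, ?_, ?_⟩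
  · rw [fisherSq_smul, inv_pow, Real.sq_sqrt (by linarith)]
    have : 0 < fisherSq k θs u := hr.trans_le hu
    field_simp
  · rw [smul_smul, mul_inv_cancel₀ (by linarith), one_smul]

/-- The likelihood has a maximum on the compact ellipsoid, and along each ray it decreases beyond
the boundary, where the score already points inwards. -/
lemma exists_isMLE (hd : 0 < d) (hT : 0 < T) (hk : Informative θs T k)
    (hE : GoodNoise θs T k (labelled k y)) : ∃ θ, IsMLE (labelled k y) θ := by
  have hd' : (0 : ℝ) < d := Nat.cast_pos.2 hd
  set B : Set (Fin d → ℝ) := {u | fisherSq k θs u ≤ 20 * d * T} with hB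
  have hclosed : IsClosed B := by
    refine isClosed_le ?_ continuous_const
    unfold fisherSq
    exact continuous_finsetSum _ fun z _ => continuous_const.mul
      ((continuous_const.dotProduct continuous_id).pow 2)
  have hcomp : IsCompact B := by
    -- Cauchy–Schwarz against the coordinate vectors puts the ellipsoid into a box.
    set b : Fin d → ℝ := fun i =>
      √(invNormSq (fisher Z (fun z => (k z : ℝ)) θs) (Pi.single i 1) * (20 * d * T))
    refine (isCompact_Icc (a := -b) (b := b)).of_isClosed_subset hclosed fun u hu => ?_
    have key : ∀ i, |u i| ≤ b i := fun i => by
      refine Real.abs_le_sqrt ?_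
      have h1 := sq_dotProduct_le_fisherSq hk.1 (Pi.single i 1) u
      rw [single_one_dotProduct] at h1
      exact h1.trans (mul_le_mul_of_nonneg_left hu (invNormSq_nonneg hk.1 _))
    exact ⟨fun i => (abs_le.1 (key i)).1, fun i => (abs_le.1 (key i)).2⟩
  have hne : B.Nonempty := ⟨0, by simp only [hB, fisherSq, Set.mem_ofPred_eq]; simp; positivity⟩
  obtain ⟨u₁, _, hmax⟩ := hcomp.exists_isMaxOn hne
    (f := fun u => logLik (labelled k y) (θs + u))
    ((continuous_logLik _).comp (continuous_const.add continuous_id)).continuousOn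
  refine ⟨θs + u₁, fun θ' => ?_⟩
  obtain ⟨u, rfl⟩ : ∃ u, θ' = θs + u := ⟨θ' - θs, by simp⟩
  rcases le_or_gt (fisherSq k θs u) (20 * d * T) with hu | hu
  · exact hmax hu
  · obtain ⟨s, u₀, hs, hu₀, rfl⟩ := exists_eq_smul_of_le hd hT hu.le
    have hanti : AntitoneOn (fun s : ℝ => logLik (labelled k y) (θs + s • u₀)) (Set.Ici 1) := by
      refine antitoneOn_of_deriv_nonpos (convex_Ici 1)
        (fun t _ => (hasDerivAt_logLik _ θs u₀ t).continuousAt.continuousWithinAt)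
        (fun t _ => (hasDerivAt_logLik _ θs u₀ t).differentiableAt.differentiableWithinAt)
        fun t ht => ?_
      rw [interior_Ici, Set.mem_Ioi] at ht
      rw [(hasDerivAt_logLik _ θs u₀ t).deriv]
      refine (score_ray_le k y θs u₀ ht.le).trans ?_
      rw [one_smul]
      exact (score_dotProduct_neg hd hT hk hE hu₀).le
    have h1 := hanti (Set.mem_Ici.2 le_rfl) (Set.mem_Ici.2 hs) hs
    simp only [one_smul] at h1
    exact h1.trans (hmax (show u₀ ∈ B from hu₀.le))

lemma IsMLE.fisherSq_le (hd : 0 < d) (hT : 0 < T) (hk : Informative θs T k)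
    (hE : GoodNoise θs T k (labelled k y)) {u : Fin d → ℝ} (hu : IsMLE (labelled k y) (θs + u)) :
    fisherSq k θs u ≤ 20 * d * T := by
  by_contra! hlt
  obtain ⟨s, u₀, hs, hu₀, rfl⟩ := exists_eq_smul_of_le hd hT hlt.le
  have h1 := score_ray_le k y θs u₀ hs
  rw [one_smul, hu.score_eq_zero] at h1
  exact absurd (score_dotProduct_neg hd hT hk hE hu₀) (not_lt.2 h1)

/-- Inside the ellipsoid strong concavity applies to the estimate itself: for its squared distance
Q, vanishing of the score gives (Q/2)² ≤ 4dT·Q. -/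
lemma IsMLE.fisherSq_le_sixteen (hd : 0 < d) (hT : 0 < T) (hk : Informative θs T k)
    (hE : GoodNoise θs T k (labelled k y)) {u : Fin d → ℝ} (hu : IsMLE (labelled k y) (θs + u)) :
    fisherSq k θs u ≤ 16 * d * T := by
  have hd' : (0 : ℝ) < d := Nat.cast_pos.2 hd
  have h0 := hu.fisherSq_le hd hT hk hE
  have h1 := half_fisherSq_le (k := k) (θs := θs) fun z hz => hk.abs_dotProduct_le hd hT h0 hz
  have h2 := hE.sq_score_dotProduct_le hk.1 u
  have h3 := score_add_dotProduct k y θs u u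
  rw [hu.score_eq_zero] at h3
  have h4 : fisherSq k θs u / 2 ≤ score (labelled k y) θs ⬝ᵥ u := by linarith
  have h5 := fisherSq_nonneg k θs u
  have h6 : (fisherSq k θs u / 2) ^ 2 ≤ 4 * d * T * fisherSq k θs u :=
    (pow_le_pow_left₀ (by positivity) h4 2).trans h2
  by_contra! hlt
  have : 0 < fisherSq k θs u := lt_trans (by positivity) hlt
  nlinarith

/-- One step of the bootstrap: a uniform bound on the errors improves the bound in each direction. -/
lemma IsMLE.abs_dotProduct_le_add (hd : 0 < d) (hT : 0 < T) (hk : Informative θs T k)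
    (hE : GoodNoise θs T k (labelled k y)) {u : Fin d → ℝ} (hu : IsMLE (labelled k y) (θs + u))
    {M : ℝ} (hM : ∀ z ∈ Z, |z ⬝ᵥ u| ≤ M) {z : Fin d → ℝ} (hz : z ∈ Z) :
    |z ⬝ᵥ u| ≤ √(invNormSq (fisher Z (fun z => (k z : ℝ)) θs) z) *
      (2 * √T + M * (4 * √(d * T))) := by
  have hd' : (0 : ℝ) < d := Nat.cast_pos.2 hd
  have hM0 : 0 ≤ M := (abs_nonneg _).trans (hM z hz)
  set H := fisher Z (fun z => (k z : ℝ)) θs with hH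
  set v := H⁻¹ *ᵥ z with hv
  have hq := invNormSq_nonneg hk.1 z
  have e1 : score (labelled k y) θs ⬝ᵥ v = ∑ z' : Z, (k z' : ℝ) *
      (Real.sigmoid ((z' : Fin d → ℝ) ⬝ᵥ (θs + u)) - Real.sigmoid ((z' : Fin d → ℝ) ⬝ᵥ θs)) *
      ((z' : Fin d → ℝ) ⬝ᵥ v) := by
    have := score_add_dotProduct k y θs u v
    rw [hu.score_eq_zero] at this
    linarith
  have e2 : z ⬝ᵥ u = ∑ z' : Z, (k z' : ℝ) * deriv Real.sigmoid ((z' : Fin d → ℝ) ⬝ᵥ θs) *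
      ((z' : Fin d → ℝ) ⬝ᵥ v) * ((z' : Fin d → ℝ) ⬝ᵥ u) := dotProduct_eq_sum hk.1 z u
  have hQv : fisherSq k θs v = invNormSq H z := (invNormSq_eq_sum hk.1 z).symm
  have b1 : |score (labelled k y) θs ⬝ᵥ v| ≤ √(invNormSq H z) * (2 * √T) := by
    refine (Real.abs_le_sqrt (hE z hz)).trans_eq ?_
    rw [mul_comm, show (4 : ℝ) * T = 2 ^ 2 * T by ring, Real.sqrt_mul hq,
      Real.sqrt_mul (by norm_num), Real.sqrt_sq (by norm_num)]
  -- The remainder of linearizing the score equation. Each term carries x² ≤ M|x| with x = z'ᵀu;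
  -- Cauchy–Schwarz then pairs v, of squared norm ‖z‖², with u, of squared norm at most 16dT.
  have b2 : |z ⬝ᵥ u - score (labelled k y) θs ⬝ᵥ v| ≤
      √(invNormSq H z) * (M * (4 * √(d * T))) := by
    have c1 : |z ⬝ᵥ u - score (labelled k y) θs ⬝ᵥ v| ≤ M * ∑ z' : Z, (k z' : ℝ) *
        deriv Real.sigmoid ((z' : Fin d → ℝ) ⬝ᵥ θs) * |(z' : Fin d → ℝ) ⬝ᵥ v| *
          |(z' : Fin d → ℝ) ⬝ᵥ u| := by
      rw [e1, e2, ← Finset.sum_sub_distrib, Finset.mul_sum]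
      refine (Finset.abs_sum_le_sum_abs _ _).trans (Finset.sum_le_sum fun z' _ => ?_)
      have h0 := hM z' z'.2
      have h00 := hk.abs_dotProduct_le hd hT (hu.fisherSq_le hd hT hk hE) z'.2
      rw [dotProduct_add]
      set x := (z' : Fin d → ℝ) ⬝ᵥ u
      set t := (z' : Fin d → ℝ) ⬝ᵥ θs
      set a := (z' : Fin d → ℝ) ⬝ᵥ v
      have h1 := abs_sigmoid_add_sub_le (t := t) (x := x) (by linarith)
      have h2 := deriv_sigmoid_pos t
      set m := deriv Real.sigmoid t
      have h3 : (k z' : ℝ) * m * a * x - k z' * (Real.sigmoid (t + x) - Real.sigmoid t) * a =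
          -(k z' * a * (Real.sigmoid (t + x) - Real.sigmoid t - m * x)) := by ring
      rw [h3, abs_neg, abs_mul, abs_mul, abs_of_nonneg (Nat.cast_nonneg _ : (0 : ℝ) ≤ k z')]
      calc (k z' : ℝ) * |a| * |Real.sigmoid (t + x) - Real.sigmoid t - m * x|
          ≤ k z' * |a| * (m * x ^ 2) := by gcongr
        _ = |x| * (k z' * m * |a| * |x|) := by rw [← sq_abs x]; ring
        _ ≤ M * (k z' * m * |a| * |x|) := by gcongr
    refine c1.trans ?_
    rw [mul_left_comm]
    refine mul_le_mul_of_nonneg_left ?_ hM0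
    have c2 := weighted_cauchy_schwarz (fisher_weight_nonneg k θs)
      (fun z' : Z => |(z' : Fin d → ℝ) ⬝ᵥ v|) (fun z' : Z => |(z' : Fin d → ℝ) ⬝ᵥ u|)
    simp only [sq_abs] at c2
    change _ ≤ fisherSq k θs v * fisherSq k θs u at c2
    refine (Real.le_sqrt_of_sq_le c2).trans ?_
    rw [hQv, Real.sqrt_mul hq]
    refine mul_le_mul_of_nonneg_left ?_ (Real.sqrt_nonneg _)
    refine (Real.sqrt_le_sqrt (hu.fisherSq_le_sixteen hd hT hk hE)).trans_eq ?_
    rw [mul_assoc, show (16 : ℝ) = 4 ^ 2 by norm_num, Real.sqrt_mul (by norm_num),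
      Real.sqrt_sq (by norm_num)]
  calc |z ⬝ᵥ u| = |score (labelled k y) θs ⬝ᵥ v + (z ⬝ᵥ u - score (labelled k y) θs ⬝ᵥ v)| := by
        congr 1; ring
    _ ≤ _ := (abs_add_le _ _).trans (add_le_add b1 b2)
    _ = _ := by ring

/-- Confidence bounds for the maximum likelihood estimate. -/
lemma IsMLE.error_le (hd : 0 < d) (hT : 0 < T) (hk : Informative θs T k)
    (hE : GoodNoise θs T k (labelled k y)) {θ : Fin d → ℝ} (hθ : IsMLE (labelled k y) θ)
    {z : Fin d → ℝ} (hz : z ∈ Z) :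
    |z ⬝ᵥ θ - z ⬝ᵥ θs| ≤ 1 / 2 ∧
      |z ⬝ᵥ θ - z ⬝ᵥ θs| ≤ 4 * √(T * invNormSq (fisher Z (fun z => (k z : ℝ)) θs) z) := by
  have hd' : (0 : ℝ) < d := Nat.cast_pos.2 hd
  obtain ⟨u, rfl⟩ : ∃ u, θ = θs + u := ⟨θ - θs, by simp⟩
  simp only [dotProduct_add, add_sub_cancel_left]
  refine ⟨hk.abs_dotProduct_le hd hT (hθ.fisherSq_le hd hT hk hE) hz, ?_⟩
  obtain ⟨z₀, hz₀, hmax⟩ := Z.exists_max_image (fun z => |z ⬝ᵥ u|) ⟨z, hz⟩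
  set M := |z₀ ⬝ᵥ u| with hM
  have hM0 : 0 ≤ M := abs_nonneg _
  have hsT : 0 < √T := Real.sqrt_pos.2 hT
  have hsd : 0 < √(d : ℝ) := Real.sqrt_pos.2 hd'
  have h0 := hθ.abs_dotProduct_le_add hd hT hk hE hmax hz₀
  rw [Real.sqrt_mul hd'.le] at h0
  -- Here 8.9 < √80. Applied to the arm with the largest error M, the bootstrap reads 8.9M√d ≤ 2 +
  -- 4M√d; hence 4M√d ≤ 2, and the remainder is no larger than the noise term.
  have h1 : √(invNormSq (fisher Z (fun z => (k z : ℝ)) θs) z₀) ≤ 1 / (8.9 * (√d * √T)) := by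
    refine Real.sqrt_le_iff.2 ⟨by positivity, (hk.2 z₀ hz₀).trans ?_⟩
    rw [div_pow, mul_pow, mul_pow, Real.sq_sqrt hd'.le, Real.sq_sqrt hT.le, one_pow, ← mul_assoc]
    gcongr
    norm_num
  have h2 : M ≤ 1 / (8.9 * (√d * √T)) * (2 * √T + M * (4 * (√d * √T))) :=
    h0.trans (mul_le_mul_of_nonneg_right h1 (by positivity))
  have h3 : M * (4 * √d) ≤ 2 := by
    rw [div_mul_eq_mul_div, le_div_iff₀ (by positivity)] at h2
    have : √T * (M * (4 * √d) - 2) ≤ √T * 0 := by nlinarith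
    linarith [le_of_mul_le_mul_left this hsT]
  refine (hθ.abs_dotProduct_le_add hd hT hk hE hmax hz).trans ?_
  rw [Real.sqrt_mul hd'.le, Real.sqrt_mul hT.le]
  calc √(invNormSq (fisher Z (fun z => (k z : ℝ)) θs) z) * (2 * √T + M * (4 * (√d * √T)))
      = √(invNormSq (fisher Z (fun z => (k z : ℝ)) θs) z) * (2 * √T + M * (4 * √d) * √T) := by ring
    _ ≤ √(invNormSq (fisher Z (fun z => (k z : ℝ)) θs) z) * (2 * √T + 2 * √T) := by gcongr
    _ = _ := by ring

end MaximumLikelihood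

/-! ### Bernstein bounds for the score with fixed pull counts. -/

section Concentration

variable {Ω : Type*} [MeasurableSpace Ω] {P : Measure Ω} [IsProbabilityMeasure P]

/-- From eˣ ≤ 1 + x + x² on [-1, 1]; the linear terms cancel. The exponent keeps the variance p(1 -
p), which for a label is μ', so that the variances add up to the Fisher information. -/
lemma bernoulli_mgf_le {p a : ℝ} (hp0 : 0 ≤ p) (hp1 : p ≤ 1) (ha : |a| ≤ 1) :
    p * Real.exp ((1 - p) * a) + (1 - p) * Real.exp ((0 - p) * a) ≤
      Real.exp (p * (1 - p) * a ^ 2) := by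
  have key : ∀ x : ℝ, |x| ≤ 1 → Real.exp x ≤ 1 + x + x ^ 2 := fun x hx => by
    have := (abs_le.1 (Real.abs_exp_sub_one_sub_id_le hx)).2
    linarith
  have h1 := key ((1 - p) * a) (by
    rw [abs_mul, abs_of_nonneg (by linarith)]
    exact mul_le_one₀ (by linarith) (abs_nonneg _) ha)
  have h2 := key ((0 - p) * a) (by
    rw [abs_mul, zero_sub, abs_neg, abs_of_nonneg hp0]
    exact mul_le_one₀ hp1 (abs_nonneg _) ha)
  have h3 := Real.add_one_le_exp (p * (1 - p) * a ^ 2)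
  calc p * Real.exp ((1 - p) * a) + (1 - p) * Real.exp ((0 - p) * a)
      ≤ p * (1 + (1 - p) * a + ((1 - p) * a) ^ 2) +
        (1 - p) * (1 + (0 - p) * a + ((0 - p) * a) ^ 2) :=
        add_le_add (mul_le_mul_of_nonneg_left h1 hp0)
          (mul_le_mul_of_nonneg_left h2 (by linarith))
    _ = p * (1 - p) * a ^ 2 + 1 := by ring
    _ ≤ _ := h3

lemma integral_bool {B : Ω → Bool} (hB : Measurable B) {p : ℝ} (hp : 0 ≤ p)
    (hP : P {x | B x = true} = ENNReal.ofReal p) (f : Bool → ℝ) :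
    ∫ x, f (B x) ∂P = p * f true + (1 - p) * f false := by
  have ht : (P.map B).real {true} = p := by
    rw [map_measureReal_apply hB (measurableSet_singleton _)]
    change (P {x | B x = true}).toReal = p
    rw [hP, ENNReal.toReal_ofReal hp]
  have : IsProbabilityMeasure (P.map B) := Measure.isProbabilityMeasure_map hB.aemeasurable
  have hf : (P.map B).real {false} = 1 - p := by
    rw [← ht, ← probReal_compl_eq_one_sub (measurableSet_singleton _)]
    congr 1
    ext b; cases b <;> simp
  rw [← integral_map hB.aemeasurable (f := f) (by fun_prop), integral_fintype (.of_finite)]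
  simp [ht, hf]

lemma bernoulli_sum_tail {ι : Type*} [Fintype ι] {B : ι → Ω → Bool}
    (hB : ∀ i, Measurable (B i)) (hind : iIndepFun B P) {p a : ι → ℝ}
    (hp0 : ∀ i, 0 ≤ p i) (hp1 : ∀ i, p i ≤ 1)
    (hP : ∀ i, P {x | B i x = true} = ENNReal.ofReal (p i)) {s : ℝ} (hs : 0 ≤ s)
    (hsa : ∀ i, |s * a i| ≤ 1) (ε : ℝ) :
    P {x | ε ≤ ∑ i, ((if B i x then (1 : ℝ) else 0) - p i) * a i} ≤
      ENNReal.ofReal (Real.exp (-s * ε + s ^ 2 * ∑ i, p i * (1 - p i) * a i ^ 2)) := by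
  set X : ι → Ω → ℝ := fun i x => ((if B i x then (1 : ℝ) else 0) - p i) * a i with hX
  have hg : ∀ i, Measurable fun b : Bool => ((if b then (1 : ℝ) else 0) - p i) * a i :=
    fun i => measurable_of_finite _
  have hXm : ∀ i, Measurable (X i) := fun i => (hg i).comp (hB i)
  have hXind : iIndepFun X P :=
    hind.comp (fun i b => ((if b then (1 : ℝ) else 0) - p i) * a i) hg
  have hint : ∀ i, Integrable (fun x => Real.exp (s * X i x)) P := fun i => by
    have : Measurable fun b : Bool => Real.exp (s * (((if b then (1 : ℝ) else 0) - p i) * a i)) :=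
      measurable_of_finite _
    refine Integrable.of_bound (this.comp (hB i)).aestronglyMeasurable
      (Real.exp (s * ((1 - p i) * a i)) + Real.exp (s * ((0 - p i) * a i)))
      (Filter.Eventually.of_forall fun x => ?_)
    simp only [hX, Real.norm_eq_abs, Real.abs_exp]
    split_ifs
    · linarith [Real.exp_pos (s * ((0 - p i) * a i))]
    · linarith [Real.exp_pos (s * ((1 - p i) * a i))]
  have hmgf : ∀ i, mgf (X i) P s ≤ Real.exp (s ^ 2 * (p i * (1 - p i) * a i ^ 2)) := fun i => by
    have h1 := integral_bool (hB i) (hp0 i) (hP i)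
      (fun b => Real.exp (s * (((if b then (1 : ℝ) else 0) - p i) * a i)))
    have h2 : mgf (X i) P s = _ := h1
    rw [h2]
    have h3 := bernoulli_mgf_le (hp0 i) (hp1 i) (hsa i)
    simp only [Bool.false_eq_true, if_true, if_false]
    convert h3 using 2
    · congr 2; ring
    · congr 2; ring
    · ring
  have hsum := measure_ge_le_exp_mul_mgf (μ := P) (X := ∑ i, X i) ε hs
    (hXind.integrable_exp_mul_sum hXm fun i _ => hint i)
  rw [hXind.mgf_sum hXm] at hsum
  have h4 : P.real {x | ε ≤ (∑ i, X i) x} ≤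
      Real.exp (-s * ε + s ^ 2 * ∑ i, p i * (1 - p i) * a i ^ 2) := by
    refine hsum.trans ?_
    rw [Real.exp_add, Finset.mul_sum, Real.exp_sum]
    exact mul_le_mul_of_nonneg_left
      (Finset.prod_le_prod (fun i _ => mgf_nonneg) fun i _ => hmgf i) (Real.exp_pos _).le
  have h5 : {x | ε ≤ ∑ i, ((if B i x then (1 : ℝ) else 0) - p i) * a i} =
      {x | ε ≤ (∑ i, X i) x} := by
    ext x; simp [hX, Finset.sum_apply]
  rw [h5, ← ofReal_measureReal]
  exact ENNReal.ofReal_le_ofReal h4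

variable {d : ℕ} {Z : Finset (Fin d → ℝ)} {k : Z → ℕ} {θs : Fin d → ℝ} {T : ℝ}
  {Y : ℕ → Z → ℕ → Ω → Bool}

lemma sum_labels_eq (k : Z → ℕ) (f : Z → ℕ → ℝ) :
    ∑ z : Z, ∑ j ∈ Finset.range (k z), f z j = ∑ i : (z : Z) × Fin (k z), f i.1 i.2 := by
  rw [Fintype.sum_sigma]
  exact Finset.sum_congr rfl fun z _ => Finset.sum_range _

lemma score_tail (hY : IsLabelTable P θs Y) (ℓ : ℕ) (k : Z → ℕ) (v : Fin d → ℝ) {s : ℝ}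
    (hs : 0 ≤ s) (hsv : ∀ z ∈ Z, |s * (z ⬝ᵥ v)| ≤ 1) (ε : ℝ) :
    P {x | ε ≤ score (labelled k fun z j => Y ℓ z j x) θs ⬝ᵥ v} ≤
      ENNReal.ofReal (Real.exp (-s * ε + s ^ 2 * fisherSq k θs v)) := by
  have hind : iIndepFun (fun i : (z : Z) × Fin (k z) => Y ℓ i.1 i.2) P := by
    have := hY.indep.precomp (g := fun i : (z : Z) × Fin (k z) => (ℓ, i.1, (i.2 : ℕ))) (by
      rintro ⟨z, j⟩ ⟨z', j'⟩ h
      simp only [Prod.mk.injEq, true_and] at h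
      obtain ⟨rfl, h⟩ := h
      rw [Fin.ext h])
    exact this
  have h := bernoulli_sum_tail (P := P) (B := fun i : (z : Z) × Fin (k z) => Y ℓ i.1 i.2)
    (fun i => hY.measurable _ _ _) hind
    (p := fun i => Real.sigmoid ((i.1 : Fin d → ℝ) ⬝ᵥ θs))
    (a := fun i => (i.1 : Fin d → ℝ) ⬝ᵥ v)
    (fun i => Real.sigmoid_nonneg _) (fun i => Real.sigmoid_le_one _)
    (fun i => hY.law _ _ _) hs (fun i => hsv _ i.1.2) ε
  have e1 : ∑ i : (z : Z) × Fin (k z), Real.sigmoid ((i.1 : Fin d → ℝ) ⬝ᵥ θs) *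
      (1 - Real.sigmoid ((i.1 : Fin d → ℝ) ⬝ᵥ θs)) * ((i.1 : Fin d → ℝ) ⬝ᵥ v) ^ 2 =
      fisherSq k θs v := by
    rw [Fintype.sum_sigma, fisherSq]
    refine Finset.sum_congr rfl fun z _ => ?_
    simp [Real.deriv_sigmoid, mul_assoc]
  rw [e1] at h
  convert h using 4 with x
  rw [score_dotProduct, sum_map_labelled, sum_labels_eq k
    (fun z j => ((if Y ℓ z j x then (1 : ℝ) else 0) - Real.sigmoid ((z : Fin d → ℝ) ⬝ᵥ θs)) *
      ((z : Fin d → ℝ) ⬝ᵥ v))]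

/-- The labels of a round with a fixed number of pulls of each arm are rarely too noisy. -/
lemma measure_not_goodNoise_le (hY : IsLabelTable P θs Y) (hd : 0 < d) (hT : 0 < T)
    (hZ : ∀ z ∈ Z, z ≠ 0) (ℓ : ℕ) (hk : Informative θs T k) :
    P {x | ¬ GoodNoise θs T k (labelled k fun z j => Y ℓ z j x)} ≤
      ENNReal.ofReal (2 * Z.card * Real.exp (-T)) := by
  have hd' : (1 : ℝ) ≤ d := Nat.one_le_cast.2 hd
  set H := fisher Z (fun z => (k z : ℝ)) θs with hH
  have key : ∀ z ∈ Z, P {x | ¬ (score (labelled k fun z j => Y ℓ z j x) θs ⬝ᵥ (H⁻¹ *ᵥ z)) ^ 2 ≤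
      4 * T * invNormSq H z} ≤ ENNReal.ofReal (2 * Real.exp (-T)) := by
    intro z hz
    have hq : 0 < invNormSq H z := invNormSq_pos hk.1 (hZ z hz)
    set q := invNormSq H z with hqdef
    have hQ : fisherSq k θs (H⁻¹ *ᵥ z) = q := (invNormSq_eq_sum hk.1 z).symm
    have hsT : 0 < √T := Real.sqrt_pos.2 hT
    have hsq : 0 < √q := Real.sqrt_pos.2 hq
    -- The parameter s = √(T/q) minimizes -sε + s²q at ε = 2√(Tq), with value -T. Informative pulls
    -- keep it in the range where the exponential moment bound is valid.
    have hsv : ∀ z' ∈ Z, |√T / √q * (z' ⬝ᵥ (H⁻¹ *ᵥ z))| ≤ 1 := fun z' hz' => by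
      refine abs_le_of_sq_le_sq ?_ zero_le_one
      have h1 := sq_dotProduct_le_fisherSq hk.1 z' (H⁻¹ *ᵥ z)
      rw [hQ] at h1
      rw [mul_pow, div_pow, Real.sq_sqrt hT.le, Real.sq_sqrt hq.le]
      calc T / q * (z' ⬝ᵥ (H⁻¹ *ᵥ z)) ^ 2 ≤ T / q * (1 / (80 * d * T) * q) := by
            gcongr
            exact h1.trans (mul_le_mul_of_nonneg_right (hk.2 z' hz') hq.le)
        _ = 1 / (80 * d) := by field_simp
        _ ≤ 1 ^ 2 := by rw [div_le_iff₀ (by positivity)]; linarith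
    have hexp : -(√T / √q) * (2 * (√T * √q)) + (√T / √q) ^ 2 * q = -T := by
      rw [div_pow, Real.sq_sqrt hT.le, Real.sq_sqrt hq.le, div_mul_cancel₀ _ hq.ne']
      have : √T / √q * (√T * √q) = T := by
        rw [div_mul_eq_mul_div, ← mul_assoc, mul_div_cancel_right₀ _ hsq.ne',
          Real.mul_self_sqrt hT.le]
      linarith
    have t1 := score_tail hY ℓ k (H⁻¹ *ᵥ z) (by positivity) hsv (2 * (√T * √q))
    have t2 := score_tail hY ℓ k (-(H⁻¹ *ᵥ z)) (s := √T / √q) (by positivity)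
      (fun z' hz' => by rw [dotProduct_neg, mul_neg, abs_neg]; exact hsv z' hz') (2 * (√T * √q))
    have hQ' : fisherSq k θs (-(H⁻¹ *ᵥ z)) = q := by
      rw [← hQ, ← neg_one_smul ℝ, fisherSq_smul]; norm_num
    rw [hQ, hexp] at t1
    rw [hQ', hexp] at t2
    rw [two_mul, ENNReal.ofReal_add (Real.exp_pos _).le (Real.exp_pos _).le]
    refine (measure_mono fun x hx => ?_).trans
      ((measure_union_le _ _).trans (add_le_add t1 t2))
    rw [Set.mem_ofPred_eq, not_le] at hx
    have h1 : 2 * (√T * √q) ≤ |score (labelled k fun z j => Y ℓ z j x) θs ⬝ᵥ (H⁻¹ *ᵥ z)| := by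
      refine (pow_le_pow_iff_left₀ (by positivity) (abs_nonneg _) two_ne_zero).1 ?_
      rw [sq_abs, mul_pow, mul_pow, Real.sq_sqrt hT.le, Real.sq_sqrt hq.le]
      linarith
    rcases le_abs.1 h1 with h | h
    · exact Or.inl h
    · exact Or.inr (by rw [Set.mem_ofPred_eq, dotProduct_neg]; exact h)
  have hsub : {x | ¬ GoodNoise θs T k (labelled k fun z j => Y ℓ z j x)} ⊆
      ⋃ z ∈ Z, {x | ¬ (score (labelled k fun z j => Y ℓ z j x) θs ⬝ᵥ (H⁻¹ *ᵥ z)) ^ 2 ≤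
        4 * T * invNormSq H z} := by
    intro x hx
    simp only [GoodNoise, Set.mem_ofPred_eq, not_forall] at hx
    obtain ⟨z, hz, h⟩ := hx
    exact Set.mem_biUnion hz h
  refine (measure_mono hsub).trans ((measure_biUnion_finset_le _ _).trans
    ((Finset.sum_le_sum key).trans_eq ?_))
  rw [Finset.sum_const, nsmul_eq_mul, ← ENNReal.ofReal_natCast, ← ENNReal.ofReal_mul (by positivity)]
  congr 1
  ring

end Concentration

/-! ### Existence of sparse optimal designs and the Kiefer–Wolfowitz bound. -/

section Designs

variable {d : ℕ} {Z : Finset (Fin d → ℝ)}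

lemma eq_zero_of_span {x : Fin d → ℝ} (hspan : Submodule.span ℝ (Z : Set (Fin d → ℝ)) = ⊤)
    (h : ∀ z ∈ Z, z ⬝ᵥ x = 0) : x = 0 := by
  have key : ∀ v : Fin d → ℝ, v ⬝ᵥ x = 0 := fun v => by
    have hv : v ∈ Submodule.span ℝ (Z : Set (Fin d → ℝ)) := by rw [hspan]; trivial
    induction hv using Submodule.span_induction with
    | mem v hv => exact h v hv
    | zero => exact zero_dotProduct x
    | add a b _ _ ha hb => rw [add_dotProduct, ha, hb, add_zero]
    | smul c a _ ha => rw [smul_dotProduct, ha, smul_zero]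
  exact dotProduct_self_eq_zero.1 (key x)

lemma gram_posDef_of_pos (hspan : Submodule.span ℝ (Z : Set (Fin d → ℝ)) = ⊤) {w : Z → ℝ}
    (hw : ∀ z, 0 < w z) : (gram Z w).PosDef := by
  rw [gram_posDef_iff]
  intro x hx
  obtain ⟨z, hz, hzx⟩ : ∃ z ∈ Z, z ⬝ᵥ x ≠ 0 := by
    by_contra! h
    exact hx (eq_zero_of_span hspan h)
  exact Finset.sum_pos' (fun z _ => mul_nonneg (hw z).le (sq_nonneg _))
    ⟨⟨z, hz⟩, Finset.mem_univ _, mul_pos (hw _) (by positivity)⟩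

/-- A bound on the norms of all arms forces the matrix to be invertible. -/
lemma gram_posDef_of_sq_le (hspan : Submodule.span ℝ (Z : Set (Fin d → ℝ)) = ⊤) {w : Z → ℝ}
    (hw : ∀ z, 0 ≤ w z) {b : ℝ}
    (h : ∀ v ∈ Z, ∀ x, (v ⬝ᵥ x) ^ 2 ≤ b * ∑ z : Z, w z * ((z : Fin d → ℝ) ⬝ᵥ x) ^ 2) :
    (gram Z w).PosDef := by
  rw [gram_posDef_iff]
  intro x hx
  refine lt_of_le_of_ne (Finset.sum_nonneg fun z _ => mul_nonneg (hw z) (sq_nonneg _)) fun h0 => hx ?_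
  refine eq_zero_of_span hspan fun z hz => ?_
  have := h z hz x
  rw [← h0, mul_zero] at this
  exact pow_eq_zero_iff two_ne_zero |>.1 (le_antisymm this (sq_nonneg _))

lemma le_maxNormSq (A : Matrix (Fin d) (Fin d) ℝ) {S : Finset (Fin d → ℝ)} {z : Fin d → ℝ}
    (hz : z ∈ S) : invNormSq A z ≤ maxNormSq A S :=
  le_ciSup (f := fun z : S => invNormSq A z) (Set.finite_range _).bddAbove ⟨z, hz⟩

lemma maxNormSq_le {A : Matrix (Fin d) (Fin d) ℝ} {S : Finset (Fin d → ℝ)} {b : ℝ} (hb : 0 ≤ b)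
    (h : ∀ z ∈ S, invNormSq A z ≤ b) : maxNormSq A S ≤ b :=
  Real.iSup_le (fun z => h z z.2) hb

lemma maxNormSq_nonneg {A : Matrix (Fin d) (Fin d) ℝ} (hA : A.PosDef) (S : Finset (Fin d → ℝ)) :
    0 ≤ maxNormSq A S :=
  Real.iSup_nonneg fun z => invNormSq_nonneg hA z

lemma continuousOn_invNormSq (z : Fin d → ℝ) :
    ContinuousOn (fun A : Matrix (Fin d) (Fin d) ℝ => invNormSq A z) {A | A.PosDef} := by
  unfold invNormSq
  intro A hA
  have hdet : A.det ≠ 0 := ((Matrix.isUnit_iff_isUnit_det A).1 (Matrix.PosDef.isUnit hA)).ne_zero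
  refine ContinuousAt.continuousWithinAt ?_
  simp only [Matrix.inv_def, Ring.inverse_eq_inv']
  have h1 : ContinuousAt (fun A : Matrix (Fin d) (Fin d) ℝ => A.det⁻¹ • A.adjugate) A :=
    ((continuous_id.matrix_det.continuousAt).inv₀ hdet).smul
      (continuous_id.matrix_adjugate).continuousAt
  have h2 : Continuous fun B : Matrix (Fin d) (Fin d) ℝ => z ⬝ᵥ (B *ᵥ z) :=
    continuous_const.dotProduct (continuous_id.matrix_mulVec continuous_const)
  exact h2.continuousAt.comp h1

lemma continuousOn_maxNormSq (S : Finset (Fin d → ℝ)) :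
    ContinuousOn (fun A : Matrix (Fin d) (Fin d) ℝ => maxNormSq A S) {A | A.PosDef} := by
  unfold maxNormSq
  rcases S.eq_empty_or_nonempty with rfl | hS
  · simpa using continuousOn_const
  · have : Nonempty S := hS.to_subtype
    simp only [← Finset.sup'_univ_eq_ciSup]
    exact ContinuousOn.finset_sup'_apply _ fun z _ => continuousOn_invNormSq (z : Fin d → ℝ)

lemma continuous_gram : Continuous (gram Z) := by
  unfold gram
  exact continuous_finsetSum _ fun z _ => (continuous_apply z).smul continuous_const

/-- Entries of `z zᵀ`, indexed by unordered pairs. -/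
def symEntries (z : Fin d → ℝ) : Sym2 (Fin d) → ℝ :=
  Sym2.lift ⟨fun i j => z i * z j, fun _ _ => mul_comm _ _⟩

lemma gram_eq_of_symEntries {w w' : Z → ℝ}
    (h : ∑ z : Z, w z • symEntries (z : Fin d → ℝ) = ∑ z : Z, w' z • symEntries (z : Fin d → ℝ)) :
    gram Z w = gram Z w' := by
  ext i j
  have := congrFun h s(i, j)
  simpa [gram, Matrix.sum_apply, Matrix.vecMulVec_apply, symEntries] using this

/-- Every design has the same moment matrix as one supported on at most `d(d+1)/2 + 1` arms. -/
lemma exists_sparse_design (c : Z → ℝ) {l : Z → ℝ} (hl : l ∈ stdSimplex ℝ Z) :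
    ∃ l' ∈ stdSimplex ℝ Z, gram Z (fun z => l' z * c z) = gram Z (fun z => l z * c z) ∧
      {z | l' z ≠ 0}.ncard ≤ d * (d + 1) / 2 + 1 := by
  classical
  set e : Z → Sym2 (Fin d) → ℝ := fun z => c z • symEntries (z : Fin d → ℝ) with he
  have hmem : ∑ z : Z, l z • e z ∈ convexHull ℝ (Set.range e) :=
    (convex_convexHull ℝ _).sum_mem (fun z _ => hl.1 z) hl.2
      fun z _ => subset_convexHull ℝ _ ⟨z, rfl⟩
  -- Carathéodory in the space of symmetric matrices, of dimension d(d+1)/2.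
  obtain ⟨ι, _, p, w, hp, hind, hw, hw1, hsum⟩ := eq_pos_convex_span_of_mem_convexHull hmem
  choose g hg using fun i => hp ⟨i, rfl⟩
  have hginj : Function.Injective g := fun i j hij => hind.injective (by rw [← hg, ← hg, hij])
  have hcard : Fintype.card ι ≤ d * (d + 1) / 2 + 1 := by
    refine hind.card_le_finrank_succ.trans (Nat.add_le_add_right ?_ 1)
    refine (Submodule.finrank_le _).trans ?_
    rw [Module.finrank_fintype_fun_eq_card, Sym2.card, Fintype.card_fin, Nat.choose_two_right,
      Nat.add_sub_cancel, mul_comm]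
  set l' : Z → ℝ := fun z => ∑ i, if g i = z then w i else 0 with hl'
  have hsum' : ∀ {M : Type} [AddCommGroup M] [Module ℝ M] (f : Z → M),
      ∑ z, l' z • f z = ∑ i, w i • f (g i) := by
    intro M _ _ f
    simp only [hl', Finset.sum_smul, ite_smul, zero_smul]
    rw [Finset.sum_comm]
    simp
  refine ⟨l', ⟨fun z => Finset.sum_nonneg fun i _ => ?_, ?_⟩, ?_, ?_⟩
  · split_ifs
    · exact (hw i).le
    · exact le_rfl
  · simpa [hw1] using hsum' (fun _ => (1 : ℝ))
  · refine gram_eq_of_symEntries ?_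
    simp only [mul_smul]
    change ∑ z, l' z • e z = ∑ z, l z • e z
    rw [hsum' e, ← hsum]
    simp only [hg]
  · have hsub : {z | l' z ≠ 0} ⊆ Set.range g := by
      intro z hz
      obtain ⟨i, _, hi⟩ := Finset.exists_ne_zero_of_sum_ne_zero hz
      exact ⟨i, by by_contra h; simp [h] at hi⟩
    refine (Set.ncard_le_ncard hsub (Set.toFinite _)).trans ?_
    rw [← Set.image_univ]
    refine (Set.ncard_image_le (Set.toFinite _)).trans ?_
    rw [Set.ncard_univ, Nat.card_eq_fintype_card]
    exact hcard

lemma exists_mem_stdSimplex_pos (hZ : Z.Nonempty) :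
    ∃ l ∈ stdSimplex ℝ Z, ∀ z, 0 < l z := by
  have hc : (0 : ℝ) < Z.card := Nat.cast_pos.2 hZ.card_pos
  refine ⟨fun _ => (Z.card : ℝ)⁻¹, ⟨fun z => by positivity, ?_⟩, fun z => by positivity⟩
  simp [ne_of_gt hc]

/-- An optimal design exists for each criterion that is continuous in the moment matrix and
dominates the largest norm of an arm. -/
lemma exists_isOptDesign (hZ : Z.Nonempty)
    (hspan : Submodule.span ℝ (Z : Set (Fin d → ℝ)) = ⊤) {c : Z → ℝ} (hc : ∀ z, 0 < c z)
    {F : Matrix (Fin d) (Fin d) ℝ → ℝ} (hF : ContinuousOn F {A | A.PosDef}) {a : ℝ} (ha : 0 < a)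
    (hFa : ∀ A : Matrix (Fin d) (Fin d) ℝ, A.PosDef → a * maxNormSq A Z ≤ F A) :
    ∃ l, IsOptDesign {l | l ∈ stdSimplex ℝ Z ∧ (gram Z fun z => l z * c z).PosDef}
      (fun l => F (gram Z fun z => l z * c z)) l := by
  obtain ⟨l₀, hl₀, hl₀pos⟩ := exists_mem_stdSimplex_pos hZ
  have hP₀ : (gram Z fun z => l₀ z * c z).PosDef :=
    gram_posDef_of_pos hspan fun z => mul_pos (hl₀pos z) (hc z)
  set b := F (gram Z fun z => l₀ z * c z) / a with hb
  have hb0 : 0 ≤ b :=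
    div_nonneg ((mul_nonneg ha.le (maxNormSq_nonneg hP₀ Z)).trans (hFa _ hP₀)) ha.le
  have hF_le : ∀ l ∈ stdSimplex ℝ Z, (gram Z fun z => l z * c z).PosDef →
      F (gram Z fun z => l z * c z) ≤ F (gram Z fun z => l₀ z * c z) →
      ∀ v ∈ Z, ∀ x, (v ⬝ᵥ x) ^ 2 ≤ b * ∑ z : Z, l z * c z * ((z : Fin d → ℝ) ⬝ᵥ x) ^ 2 := by
    intro l hl hP hle v hv x
    have hw : ∀ z, 0 ≤ l z * c z := fun z => mul_nonneg (hl.1 z) (hc z).le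
    refine (sq_dotProduct_le hw hP v x).trans (mul_le_mul_of_nonneg_right ?_
      (Finset.sum_nonneg fun z _ => mul_nonneg (hw z) (sq_nonneg _)))
    rw [hb, le_div_iff₀ ha, mul_comm]
    exact (mul_le_mul_of_nonneg_left (le_maxNormSq _ hv) ha.le).trans ((hFa _ hP).trans hle)
  -- Positive definiteness alone is not a closed condition. These closed conditions imply it and
  -- hold for every design at least as good as l₀, so the minimum may be sought on the compact set
  -- K.
  set K : Set (Z → ℝ) := stdSimplex ℝ Z ∩ {l | ∀ v ∈ Z, ∀ x,
    (v ⬝ᵥ x) ^ 2 ≤ b * ∑ z : Z, l z * c z * ((z : Fin d → ℝ) ⬝ᵥ x) ^ 2} with hK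
  have hKP : ∀ l ∈ K, (gram Z fun z => l z * c z).PosDef := fun l hl =>
    gram_posDef_of_sq_le hspan (fun z => mul_nonneg (hl.1.1 z) (hc z).le) hl.2
  have hKc : IsCompact K := by
    refine (isCompact_stdSimplex ℝ Z).inter_right ?_
    simp only [Set.ofPred_forall]
    refine isClosed_iInter fun v => isClosed_iInter fun hv => isClosed_iInter fun x => ?_
    refine isClosed_le continuous_const (continuous_const.mul ?_)
    exact continuous_finsetSum _ fun z _ =>
      ((continuous_apply z).mul continuous_const).mul continuous_const
  have hG : Continuous fun l : Z → ℝ => gram Z fun z => l z * c z :=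
    continuous_gram.comp (continuous_pi fun z => (continuous_apply z).mul continuous_const)
  have hl₀K : l₀ ∈ K := ⟨hl₀, hF_le l₀ hl₀ hP₀ le_rfl⟩
  obtain ⟨l₁, hl₁, hmin⟩ := hKc.exists_isMinOn ⟨l₀, hl₀K⟩
    (f := fun l => F (gram Z fun z => l z * c z)) (hF.comp hG.continuousOn hKP)
  obtain ⟨l', hl', hgram, hcard⟩ := exists_sparse_design c hl₁.1
  refine ⟨l', ⟨hl', by rw [hgram]; exact hKP l₁ hl₁⟩, ?_, hcard⟩
  rintro l ⟨hl, hP⟩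
  simp only [Set.mem_ofPred_eq]
  rw [hgram]
  rcases le_or_gt (F (gram Z fun z => l z * c z)) (F (gram Z fun z => l₀ z * c z)) with h | h
  · exact hmin ⟨hl, hF_le l hl hP h⟩
  · exact (hmin hl₀K).trans h.le

/-- The Kiefer–Wolfowitz bound: a design that maximizes the determinant has norms at most `d`. -/
lemma exists_design_maxNormSq_le (hZ : Z.Nonempty) (hd : 0 < d)
    (hspan : Submodule.span ℝ (Z : Set (Fin d → ℝ)) = ⊤) :
    ∃ l ∈ warmDesigns Z, maxNormSq (gram Z l) Z ≤ d := by
  classical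
  obtain ⟨l₀, hl₀, hl₀pos⟩ := exists_mem_stdSimplex_pos hZ
  have hP₀ : (gram Z l₀).PosDef := gram_posDef_of_pos hspan hl₀pos
  obtain ⟨l, hl, hmax⟩ := (isCompact_stdSimplex ℝ Z).exists_isMaxOn ⟨l₀, hl₀⟩
    (f := fun l => (gram Z l).det) continuous_gram.matrix_det.continuousOn
  have hdet : 0 < (gram Z l).det := hP₀.det_pos.trans_le (hmax hl₀)
  have hP : (gram Z l).PosDef := by
    have hsemi : (gram Z l).PosSemidef := by
      refine Matrix.PosSemidef.of_dotProduct_mulVec_nonneg (gram_isHermitian l) fun x => ?_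
      rw [star_trivial, dotProduct_gram_mulVec]
      refine Finset.sum_nonneg fun z _ => ?_
      rw [mul_assoc]
      exact mul_nonneg (hl.1 z) (mul_self_nonneg _)
    exact hsemi.posDef_iff_isUnit.2 ((Matrix.isUnit_iff_isUnit_det _).2 hdet.ne'.isUnit)
  refine ⟨l, ⟨hl, hP⟩, maxNormSq_le (Nat.cast_nonneg d) fun v hv => ?_⟩
  set q := invNormSq (gram Z l) v with hq
  have hq0 : 0 ≤ q := invNormSq_nonneg hP v
  -- Moving mass t to the arm v cannot increase the determinant; the rank-one determinant formula
  -- gives the ratio.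
  have key : ∀ t : ℝ, 0 < t → t < 1 → (1 - t) ^ d * (1 + t / (1 - t) * q) ≤ 1 := by
    intro t ht0 ht1
    have ht : 0 < 1 - t := by linarith
    set l' : Z → ℝ := (1 - t) • l + t • Pi.single ⟨v, hv⟩ 1 with hl'
    have hl'mem : l' ∈ stdSimplex ℝ Z :=
      convex_stdSimplex ℝ Z hl (single_mem_stdSimplex ℝ _) ht.le ht0.le (by ring)
    have hgram : gram Z l' = (1 - t) • (gram Z l +
        Matrix.replicateCol Unit ((t / (1 - t)) • v) * Matrix.replicateRow Unit v) := by
      have h1 : gram Z l' = (1 - t) • gram Z l + t • Matrix.vecMulVec v v := by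
        simp only [gram, hl', Pi.add_apply, Pi.smul_apply, smul_eq_mul, add_smul,
          Finset.sum_add_distrib, Finset.smul_sum, mul_smul]
        congr 1
        rw [Finset.sum_eq_single ⟨v, hv⟩]
        · simp
        · intro z _ hz
          simp [Pi.single_eq_of_ne hz]
        · simp
      rw [h1, ← Matrix.vecMulVec_eq, Matrix.smul_vecMulVec, smul_add, smul_smul,
        mul_div_cancel₀ _ ht.ne']
    have h2 : (gram Z l').det = (1 - t) ^ d * ((gram Z l).det * (1 + t / (1 - t) * q)) := by
      rw [hgram, Matrix.det_smul, Fintype.card_fin,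
        Matrix.det_add_replicateCol_mul_replicateRow hdet.ne'.isUnit]
      congr 2
      rw [Matrix.det_unique]
      simp [Matrix.mul_apply, hq, invNormSq, dotProduct, Matrix.mulVec, Finset.mul_sum,
        Finset.sum_mul]
      rw [Finset.sum_comm]
      exact Finset.sum_congr rfl fun i _ => Finset.sum_congr rfl fun j _ => by ring
    have h3 := hmax hl'mem
    simp only [Set.mem_ofPred_eq] at h3
    rw [h2] at h3
    have h4 : (gram Z l).det * ((1 - t) ^ d * (1 + t / (1 - t) * q)) ≤ (gram Z l).det * 1 := by
      linarith
    exact le_of_mul_le_mul_left h4 hdet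
  -- The first-order condition at t = 0 with an explicit remainder from Bernoulli's inequality. If q
  -- > d, a small enough t contradicts it.
  have key2 : ∀ t : ℝ, 0 < t → t < 1 → q - d ≤ t * ((d - 1) * (q - 1)) := by
    intro t ht0 ht1
    have ht : 0 < 1 - t := by linarith
    obtain ⟨n, rfl⟩ : ∃ n, d = n + 1 := ⟨d - 1, by omega⟩
    have h1 := key t ht0 ht1
    have h2 : (1 - t) ^ (n + 1) * (1 + t / (1 - t) * q) = (1 - t) ^ n * (1 - t + t * q) := by
      rw [pow_succ]; field_simp
    have h3 : 1 + (n : ℝ) * (-t) ≤ (1 + -t) ^ n := one_add_mul_le_pow (by linarith) n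
    have h4 : (1 + (n : ℝ) * (-t)) * (1 - t + t * q) ≤ 1 := by
      refine (mul_le_mul_of_nonneg_right h3 (by positivity)).trans ?_
      rw [← sub_eq_add_neg, ← h2]
      exact h1
    push_cast
    have h5 : t * (q - (n + 1) - t * ((n + 1 - 1) * (q - 1))) ≤ t * 0 := by
      ring_nf at h4 ⊢
      linarith
    linarith [le_of_mul_le_mul_left h5 ht0]
  by_contra! hlt
  set C := ((d : ℝ) - 1) * (q - 1) with hC
  have hd1 : (1 : ℝ) ≤ d := Nat.one_le_cast.2 hd
  have hC0 : 0 ≤ C := mul_nonneg (by linarith) (by linarith)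
  have hs : 0 < min (1 / 2) ((q - d) / (2 * (C + 1))) :=
    lt_min (by norm_num) (div_pos (by linarith) (by linarith))
  have h1 := key2 _ hs ((min_le_left _ _).trans_lt (by norm_num))
  have h2 : min (1 / 2) ((q - d) / (2 * (C + 1))) * C ≤ (q - d) / (2 * (C + 1)) * C :=
    mul_le_mul_of_nonneg_right (min_le_right _ _) hC0
  have h3 : (q - d) / (2 * (C + 1)) * C < q - d := by
    rw [div_mul_eq_mul_div, div_lt_iff₀ (by linarith)]
    nlinarith
  linarith

end Designs

/-! ### Efficient apportionment of samples. -/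

section Rounding

variable {d : ℕ} {Z : Finset (Fin d → ℝ)}

/-- Greedy allocation: the next sample goes to an arm with the smallest ratio k z / l z, and this
ratio is the new common multiplier. -/
lemma exists_isEfficientRounding {l : Z → ℝ} (hl : l ∈ stdSimplex ℝ Z) (n : ℕ) :
    ∃ k, IsEfficientRounding l n k := by
  classical
  have hpos : ∀ z, l z ≠ 0 → 0 < l z := fun z hz => lt_of_le_of_ne (hl.1 z) hz.symm
  induction n with
  | zero => exact ⟨0, fun _ _ => rfl, by simp, 0, fun z _ => by simp⟩
  | succ n ih =>
    obtain ⟨k, hk0, hkn, ν, hν⟩ := ih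
    have hne : (Finset.univ.filter fun z => l z ≠ 0).Nonempty := by
      obtain ⟨z, hz, h⟩ := Finset.exists_ne_zero_of_sum_ne_zero
        (by rw [hl.2]; exact one_ne_zero : ∑ z, l z ≠ 0)
      exact ⟨z, by simpa using h⟩
    obtain ⟨z₀, hz₀, hmin⟩ := Finset.exists_min_image _ (fun z => (k z : ℝ) / l z) hne
    simp only [Finset.mem_filter, Finset.mem_univ, true_and] at hz₀ hmin
    refine ⟨k + Pi.single z₀ 1, fun z hz => ?_, ?_, (k z₀ : ℝ) / l z₀, fun z hz => ?_⟩
    · have : z ≠ z₀ := by rintro rfl; exact hz₀ hz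
      simp [hk0 z hz, this]
    · simp only [Pi.add_apply, Finset.sum_add_distrib, hkn, Finset.sum_pi_single',
        Finset.mem_univ, if_true]
    · by_cases h : z = z₀
      · subst h
        rw [div_mul_cancel₀ _ hz]
        simp
      · have h1 := (le_div_iff₀ (hpos z hz)).1 (hmin z hz)
        have h2 := (hν z hz).2
        have h3 : ν ≤ (k z₀ : ℝ) / l z₀ := (le_div_iff₀ (hpos z₀ hz₀)).2 (hν z₀ hz₀).1
        have h4 := mul_le_mul_of_nonneg_right h3 (hl.1 z)
        simp only [Pi.add_apply, Pi.single_eq_of_ne h, add_zero]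
        exact ⟨h1, by linarith⟩

/-- The multiplier of an efficient rounding loses at most one sample per arm of the support. -/
lemma IsEfficientRounding.exists_le {l : Z → ℝ} (hl : l ∈ stdSimplex ℝ Z) {n : ℕ} {k : Z → ℕ}
    (hk : IsEfficientRounding l n k) :
    ∃ ν : ℝ, (n : ℝ) - {z | l z ≠ 0}.ncard ≤ ν ∧ ∀ z, ν * l z ≤ k z := by
  classical
  obtain ⟨hk0, hkn, ν, hν⟩ := hk
  refine ⟨ν, ?_, fun z => ?_⟩
  · have h1 : (n : ℝ) ≤ ∑ z, (ν * l z + if l z ≠ 0 then 1 else 0) := by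
      rw [← hkn, Nat.cast_sum]
      refine Finset.sum_le_sum fun z _ => ?_
      by_cases h : l z = 0
      · simp [h, hk0 z h]
      · simpa [h] using (hν z h).2
    rw [Finset.sum_add_distrib, ← Finset.mul_sum, hl.2, mul_one, Finset.sum_boole] at h1
    have h2 : {z | l z ≠ 0}.ncard = (Finset.univ.filter fun z => l z ≠ 0).card := by
      rw [← Set.ncard_coe_finset]
      simp
    rw [h2]
    linarith
  · by_cases h : l z = 0
    · simp [h]
    · exact (hν z h).1

end Rounding

/-! ### Adaptive pull counts: measurability, independence and the union over rounds. -/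

section Adaptivity

variable {Ω : Type*}

/-- `f` has countably many values and is measurable for the discrete `σ`-algebra. -/
def DiscreteMeasurable {α : Type*} (m : MeasurableSpace Ω) (f : Ω → α) : Prop :=
  (Set.range f).Countable ∧ ∀ S : Set α, MeasurableSet[m] (f ⁻¹' S)

lemma DiscreteMeasurable.const {α : Type*} (m : MeasurableSpace Ω) (a : α) :
    DiscreteMeasurable m fun _ : Ω => a :=
  ⟨(Set.countable_singleton a).mono (by rintro _ ⟨x, rfl⟩; rfl),
    fun S => @MeasurableSet.const _ m (a ∈ S)⟩

/-- Conditioning on the countably many values of f. Since all sets of values count as measurable,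
the rules of the algorithm may be arbitrary functions. -/
lemma DiscreteMeasurable.bind {α β : Type*} {m : MeasurableSpace Ω} {f : Ω → α}
    (hf : DiscreteMeasurable m f) {g : α → Ω → β} (hg : ∀ a, DiscreteMeasurable m (g a)) :
    DiscreteMeasurable m fun x => g (f x) x := by
  refine ⟨(hf.1.biUnion fun a _ => (hg a).1).mono ?_, fun S => ?_⟩
  · rintro _ ⟨x, rfl⟩
    exact Set.mem_biUnion ⟨x, rfl⟩ ⟨x, rfl⟩
  · have h : (fun x => g (f x) x) ⁻¹' S = ⋃ a ∈ Set.range f, f ⁻¹' {a} ∩ g a ⁻¹' S := by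
      ext x
      simp only [Set.mem_iUnion, Set.mem_inter_iff, Set.mem_preimage, Set.mem_singleton_iff]
      constructor
      · exact fun hx => ⟨f x, ⟨x, rfl⟩, rfl, hx⟩
      · rintro ⟨a, _, rfl, hx⟩
        exact hx
    rw [h]
    exact MeasurableSet.biUnion hf.1 fun a _ => (hf.2 {a}).inter ((hg a).2 S)

lemma DiscreteMeasurable.comp {α β : Type*} {m : MeasurableSpace Ω} {f : Ω → α}
    (hf : DiscreteMeasurable m f) (g : α → β) : DiscreteMeasurable m fun x => g (f x) :=
  hf.bind fun a => .const m (g a)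

lemma DiscreteMeasurable.mono {α : Type*} {m m' : MeasurableSpace Ω} (h : m ≤ m') {f : Ω → α}
    (hf : DiscreteMeasurable m f) : DiscreteMeasurable m' f :=
  ⟨hf.1, fun S => h _ (hf.2 S)⟩

/-- An event with a parameter chosen independently of it is as unlikely as for fixed parameters. -/
lemma measure_adaptive_le {α : Type*} [Countable α] [mΩ : MeasurableSpace Ω] {P : Measure Ω}
    [IsProbabilityMeasure P] {m₁ m₂ : MeasurableSpace Ω} (hm₁ : m₁ ≤ mΩ) (hind : Indep m₁ m₂ P)
    {κ : Ω → α} (hκ : DiscreteMeasurable m₁ κ) {B : α → Set Ω}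
    (hB : ∀ a, MeasurableSet[m₂] (B a)) {ε : ENNReal} (hε : ∀ a, P (B a) ≤ ε) :
    P {x | x ∈ B (κ x)} ≤ ε := by
  have h : {x | x ∈ B (κ x)} ⊆ ⋃ a, κ ⁻¹' {a} ∩ B a := fun x hx =>
    Set.mem_iUnion.2 ⟨κ x, rfl, hx⟩
  calc P {x | x ∈ B (κ x)} ≤ ∑' a, P (κ ⁻¹' {a} ∩ B a) :=
        (measure_mono h).trans (measure_iUnion_le _)
    _ ≤ ∑' a, P (κ ⁻¹' {a}) * ε := by
        refine ENNReal.tsum_le_tsum fun a => ?_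
        rw [(Indep_iff _ _ _).1 hind _ _ (hκ.2 {a}) (hB a)]
        gcongr
        exact hε a
    _ = P (⋃ a, κ ⁻¹' {a}) * ε := by
        rw [ENNReal.tsum_mul_right, measure_iUnion _ fun a => hm₁ _ (hκ.2 {a})]
        exact fun a b hab => Set.disjoint_left.2 fun x hx hx' => hab (hx.symm.trans hx')
    _ ≤ 1 * ε := by gcongr; exact prob_le_one
    _ = ε := one_mul ε

variable {d : ℕ} {Z : Finset (Fin d → ℝ)}

/-- The `σ`-algebra of the labels of the rounds in `S`. -/
abbrev labelAlgebra (Y : ℕ → Z → ℕ → Ω → Bool) (S : Set ℕ) : MeasurableSpace Ω :=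
  ⨆ i ∈ {i : ℕ × Z × ℕ | i.1 ∈ S}, MeasurableSpace.comap (Y i.1 i.2.1 i.2.2) ⊤

lemma labelAlgebra_mono (Y : ℕ → Z → ℕ → Ω → Bool) {S S' : Set ℕ} (h : S ⊆ S') :
    labelAlgebra Y S ≤ labelAlgebra Y S' :=
  biSup_mono fun _ hi => h hi

lemma discreteMeasurable_labelled (Y : ℕ → Z → ℕ → Ω → Bool) {S : Set ℕ} {ℓ : ℕ} (hℓ : ℓ ∈ S)
    (k : Z → ℕ) :
    DiscreteMeasurable (labelAlgebra Y S) fun x => labelled k fun z j => Y ℓ z j x := by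
  set r : Ω → ((z : Z) × Fin (k z)) → Bool := fun x i => Y ℓ i.1 i.2 x with hr
  have hrm : Measurable[labelAlgebra Y S] r := by
    refine @measurable_pi_lambda _ _ _ (labelAlgebra Y S) _ _ fun i => ?_
    have h1 : MeasurableSpace.comap (Y ℓ i.1 i.2) ⊤ ≤ labelAlgebra Y S :=
      le_biSup (fun i : ℕ × Z × ℕ => MeasurableSpace.comap (Y i.1 i.2.1 i.2.2) ⊤)
        (show (ℓ, i.1, (i.2 : ℕ)) ∈ {i : ℕ × Z × ℕ | i.1 ∈ S} from hℓ)
    exact measurable_iff_comap_le.2 h1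
  have hrd : DiscreteMeasurable (labelAlgebra Y S) r :=
    ⟨Set.to_countable _, fun S => hrm (Set.toFinite S).measurableSet⟩
  -- Only finitely many labels are read; the default `false` never enters the data.
  have h2 := hrd.comp fun b => labelled k fun z j => if h : j < k z then b ⟨z, j, h⟩ else false
  convert h2 using 2 with x
  unfold labelled
  refine Finset.sum_congr rfl fun z _ => Multiset.map_congr rfl fun j hj => ?_
  simp [hr, Multiset.mem_range.1 hj]

/-- The numbers of pulls in round `ℓ`, where round `0` is the warm-up. -/
noncomputable def roundPulls (R : Rules Z) (δ ω : ℝ) (θstar : Fin d → ℝ)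
    (y : ℕ → Z → ℕ → Bool) : ℕ → Z → ℕ
  | 0 => warmPulls R δ ω θstar
  | ℓ + 1 => pulls R δ ω (ℓ + 1) (run R δ ω θstar y ℓ)

lemma run_fst (R : Rules Z) (δ ω : ℝ) (θstar : Fin d → ℝ) (y : ℕ → Z → ℕ → Bool) (ℓ : ℕ) :
    (run R δ ω θstar y ℓ).1 = R.est (labelled (roundPulls R δ ω θstar y ℓ) (y ℓ)) := by
  cases ℓ <;> rfl

lemma discreteMeasurable_run (R : Rules Z) (δ ω : ℝ) (θstar : Fin d → ℝ)
    (Y : ℕ → Z → ℕ → Ω → Bool) (ℓ : ℕ) :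
    DiscreteMeasurable (labelAlgebra Y (Set.Iic ℓ))
      fun x => run R δ ω θstar (fun ℓ z j => Y ℓ z j x) ℓ := by
  induction ℓ with
  | zero =>
    exact (discreteMeasurable_labelled Y (Set.mem_Iic.2 le_rfl) _).comp fun D => (R.est D, Z)
  | succ ℓ ih =>
    refine (ih.mono (labelAlgebra_mono Y (Set.Iic_subset_Iic.2 ℓ.le_succ))).bind
      (g := fun s x => (R.est (labelled (pulls R δ ω (ℓ + 1) s) fun z j => Y (ℓ + 1) z j x),
        s.2.filter fun z => ¬ eps (ℓ + 1) <
          |z ⬝ᵥ R.est (labelled (pulls R δ ω (ℓ + 1) s) fun z j => Y (ℓ + 1) z j x)|)) fun s => ?_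
    exact (discreteMeasurable_labelled Y (Set.mem_Iic.2 le_rfl) (pulls R δ ω (ℓ + 1) s)).comp
      fun D => (R.est D, s.2.filter fun z => ¬ eps (ℓ + 1) < |z ⬝ᵥ R.est D|)

lemma discreteMeasurable_roundPulls (R : Rules Z) (δ ω : ℝ) (θstar : Fin d → ℝ)
    (Y : ℕ → Z → ℕ → Ω → Bool) (ℓ : ℕ) :
    DiscreteMeasurable (labelAlgebra Y (Set.Iio ℓ))
      fun x => roundPulls R δ ω θstar (fun ℓ z j => Y ℓ z j x) ℓ := by
  cases ℓ with
  | zero => exact .const _ _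
  | succ ℓ =>
    have h := (discreteMeasurable_run R δ ω θstar Y ℓ).comp fun s => pulls R δ ω (ℓ + 1) s
    exact h.mono (labelAlgebra_mono Y fun i hi => Nat.lt_succ_of_le hi)

lemma IsLabelTable.labelAlgebra_le [mΩ : MeasurableSpace Ω] {P : Measure Ω}
    {θstar : Fin d → ℝ} {Y : ℕ → Z → ℕ → Ω → Bool} (hY : IsLabelTable P θstar Y) (S : Set ℕ) :
    labelAlgebra Y S ≤ mΩ :=
  iSup₂_le fun i _ => (hY.measurable i.1 i.2.1 i.2.2).comap_le

lemma IsLabelTable.indep_labelAlgebra [MeasurableSpace Ω] {P : Measure Ω}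
    {θstar : Fin d → ℝ} {Y : ℕ → Z → ℕ → Ω → Bool} (hY : IsLabelTable P θstar Y) {S S' : Set ℕ}
    (h : Disjoint S S') : Indep (labelAlgebra Y S) (labelAlgebra Y S') P :=
  indep_iSup_of_disjoint
    (m := fun i : ℕ × Z × ℕ => MeasurableSpace.comap (Y i.1 i.2.1 i.2.2) ⊤)
    (fun i => (hY.measurable i.1 i.2.1 i.2.2).comap_le) hY.indep.iIndep
    (Set.disjoint_left.2 fun _ hi hj => Set.disjoint_left.1 h hi hj)

/-- The confidence level of round `ℓ`; the warm-up uses that of round `1`. -/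
noncomputable def level (Z : Finset (Fin d → ℝ)) (δ : ℝ) (ℓ : ℕ) : ℝ := logTerm Z δ (max 1 ℓ)

lemma six_le_logTerm_arg (hZ : Z.Nonempty) {δ : ℝ} (hδ0 : 0 < δ) (hδ1 : δ < 1) {ℓ : ℕ}
    (hℓ : 1 ≤ ℓ) : 6 ≤ 2 * (ℓ : ℝ) ^ 2 * Z.card * (2 + Z.card) / δ := by
  have hc : (1 : ℝ) ≤ Z.card := Nat.one_le_cast.2 hZ.card_pos
  have hl : (1 : ℝ) ≤ ℓ := Nat.one_le_cast.2 hℓ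
  rw [le_div_iff₀ hδ0]
  have h1 : (1 : ℝ) ≤ (ℓ : ℝ) ^ 2 := one_le_pow₀ hl
  calc 6 * δ ≤ 2 * 1 * 1 * (2 + 1) := by linarith
    _ ≤ 2 * (ℓ : ℝ) ^ 2 * Z.card * (2 + Z.card) := by gcongr

lemma five_thirds_le_log_six : (5 : ℝ) / 3 ≤ Real.log 6 := by
  rw [Real.le_log_iff_exp_le (by norm_num)]
  refine le_of_pow_le_pow_left₀ three_ne_zero (by norm_num) ?_
  rw [← Real.exp_nat_mul, show ((3 : ℕ) : ℝ) * (5 / 3) = (5 : ℕ) * 1 by norm_num, Real.exp_nat_mul]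
  calc Real.exp 1 ^ 5 ≤ 2.72 ^ 5 := by
        gcongr
        exact Real.exp_one_lt_d9.le.trans (by norm_num)
    _ ≤ 6 ^ 3 := by norm_num

lemma five_thirds_le_logTerm (hZ : Z.Nonempty) {δ : ℝ} (hδ0 : 0 < δ) (hδ1 : δ < 1) {ℓ : ℕ}
    (hℓ : 1 ≤ ℓ) : 5 / 3 ≤ logTerm Z δ ℓ :=
  five_thirds_le_log_six.trans
    (Real.log_le_log (by norm_num) (six_le_logTerm_arg hZ hδ0 hδ1 hℓ))

/-- The factor 2|Z| in the logarithm pays for two tails per arm; the factor 2 + |Z| ≥ 3 pays for the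
sum over rounds, which is at most 3. -/
lemma two_card_mul_exp_neg_level_le (hZ : Z.Nonempty) {δ : ℝ} (hδ0 : 0 < δ) (hδ1 : δ < 1)
    (ℓ : ℕ) :
    2 * Z.card * Real.exp (-level Z δ ℓ) ≤ δ / 3 * (((max 1 ℓ : ℕ) : ℝ) ^ 2)⁻¹ := by
  have hc : (1 : ℝ) ≤ Z.card := Nat.one_le_cast.2 hZ.card_pos
  have h6 := six_le_logTerm_arg hZ hδ0 hδ1 (le_max_left 1 ℓ)
  have hl : (1 : ℝ) ≤ (max 1 ℓ : ℕ) := Nat.one_le_cast.2 (le_max_left 1 ℓ)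
  rw [level, logTerm, Real.exp_neg, Real.exp_log (by linarith)]
  set a := ((max 1 ℓ : ℕ) : ℝ)
  rw [inv_div]
  calc 2 * (Z.card : ℝ) * (δ / (2 * a ^ 2 * Z.card * (2 + Z.card)))
      = δ / (2 + Z.card) * (a ^ 2)⁻¹ := by field_simp
    _ ≤ δ / 3 * (a ^ 2)⁻¹ := by gcongr; linarith

/-- Rounds 0 and 1 contribute 1 each; the rest telescopes to at most 1. -/
lemma sum_inv_sq_le (n : ℕ) :
    ∑ i ∈ Finset.range n, (((max 1 i : ℕ) : ℝ) ^ 2)⁻¹ ≤ 3 := by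
  have key : ∀ n : ℕ, ∑ i ∈ Finset.range (n + 2), (((max 1 i : ℕ) : ℝ) ^ 2)⁻¹ ≤
      3 - 1 / ((n : ℝ) + 1) := by
    intro n
    induction n with
    | zero => norm_num [Finset.sum_range_succ]
    | succ n ih =>
      rw [Finset.sum_range_succ]
      have h1 : max 1 (n + 2) = n + 2 := by omega
      rw [h1, Nat.cast_add n 2, Nat.cast_ofNat, Nat.cast_succ]
      have h2 : (((n : ℝ) + 2) ^ 2)⁻¹ ≤ 1 / ((n : ℝ) + 1) - 1 / ((n : ℝ) + 1 + 1) := by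
        rw [div_sub_div _ _ (by positivity) (by positivity), inv_eq_one_div,
          div_le_div_iff₀ (by positivity) (by positivity)]
        nlinarith [(Nat.cast_nonneg n : (0 : ℝ) ≤ n)]
      linarith
  refine (Finset.sum_le_sum_of_subset_of_nonneg (Finset.range_mono (by omega : n ≤ n + 2))
    fun i _ _ => by positivity).trans ((key n).trans ?_)
  have : (0 : ℝ) ≤ 1 / ((n : ℝ) + 1) := by positivity
  linarith

/-- With high probability, the noise is small in all rounds with informative pulls. -/
lemma measure_goodNoise_ge [mΩ : MeasurableSpace Ω] {P : Measure Ω} [IsProbabilityMeasure P]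
    {θstar : Fin d → ℝ} {Y : ℕ → Z → ℕ → Ω → Bool} (hY : IsLabelTable P θstar Y) (hd : 0 < d)
    (hZ : Z.Nonempty) (hZ0 : ∀ z ∈ Z, z ≠ 0) {δ ω : ℝ} (hδ0 : 0 < δ) (hδ1 : δ < 1)
    (R : Rules Z) :
    ENNReal.ofReal (1 - δ) ≤ P {x | ∀ ℓ,
      Informative θstar (level Z δ ℓ) (roundPulls R δ ω θstar (fun ℓ z j => Y ℓ z j x) ℓ) →
      GoodNoise θstar (level Z δ ℓ) (roundPulls R δ ω θstar (fun ℓ z j => Y ℓ z j x) ℓ)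
        (labelled (roundPulls R δ ω θstar (fun ℓ z j => Y ℓ z j x) ℓ) fun z j => Y ℓ z j x)} := by
  -- Uninformative counts give the empty set, so the tail bound holds for every k.
  set B : ℕ → (Z → ℕ) → Set Ω := fun ℓ k => {x | ¬ (Informative θstar (level Z δ ℓ) k →
    GoodNoise θstar (level Z δ ℓ) k (labelled k fun z j => Y ℓ z j x))} with hB
  have hBm : ∀ ℓ k, MeasurableSet[labelAlgebra Y {ℓ}] (B ℓ k) := fun ℓ k =>
    (discreteMeasurable_labelled Y (Set.mem_singleton ℓ) k).2
      {D | ¬ (Informative θstar (level Z δ ℓ) k → GoodNoise θstar (level Z δ ℓ) k D)}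
  have hBP : ∀ ℓ k, P (B ℓ k) ≤
      ENNReal.ofReal (δ / 3 * (((max 1 ℓ : ℕ) : ℝ) ^ 2)⁻¹) := fun ℓ k => by
    by_cases hk : Informative θstar (level Z δ ℓ) k
    · have hT : 0 < level Z δ ℓ :=
        lt_of_lt_of_le (by norm_num) (five_thirds_le_logTerm hZ hδ0 hδ1 (le_max_left 1 ℓ))
      have h := measure_not_goodNoise_le hY hd hT hZ0 ℓ hk
      simp only [hB, hk, true_imp_iff]
      exact h.trans (ENNReal.ofReal_le_ofReal (two_card_mul_exp_neg_level_le hZ hδ0 hδ1 ℓ))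
    · simp [hB, hk]
  have hround : ∀ ℓ, P {x | x ∈ B ℓ (roundPulls R δ ω θstar (fun ℓ z j => Y ℓ z j x) ℓ)} ≤
      ENNReal.ofReal (δ / 3 * (((max 1 ℓ : ℕ) : ℝ) ^ 2)⁻¹) := fun ℓ =>
    measure_adaptive_le (hY.labelAlgebra_le (Set.Iio ℓ))
      (hY.indep_labelAlgebra (S := Set.Iio ℓ) (S' := {ℓ}) (by simp))
      (discreteMeasurable_roundPulls R δ ω θstar Y ℓ) (hBm ℓ) (hBP ℓ)
  set bad : Set Ω := ⋃ ℓ, {x | x ∈ B ℓ (roundPulls R δ ω θstar (fun ℓ z j => Y ℓ z j x) ℓ)}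
  have hbad : P bad ≤ ENNReal.ofReal δ := by
    refine (measure_iUnion_le _).trans ((ENNReal.tsum_le_tsum hround).trans ?_)
    refine ENNReal.tsum_le_of_sum_range_le fun n => ?_
    rw [← ENNReal.ofReal_sum_of_nonneg fun i _ => by positivity, ← Finset.mul_sum]
    refine ENNReal.ofReal_le_ofReal ?_
    have := mul_le_mul_of_nonneg_left (sum_inv_sq_le n) (by positivity : 0 ≤ δ / 3)
    linarith
  -- Subadditivity suffices here, so measurability of `bad` is not needed.
  have hcover : (1 : ENNReal) ≤ P badᶜ + P bad := by
    rw [← measure_univ (μ := P), ← Set.compl_union_self bad]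
    exact measure_union_le _ _
  rw [ENNReal.ofReal_sub _ hδ0.le, ENNReal.ofReal_one]
  refine tsub_le_iff_right.2 (hcover.trans (add_le_add (measure_mono fun x hx ℓ => ?_) hbad))
  by_contra h
  exact hx (Set.mem_iUnion.2 ⟨ℓ, h⟩)

end Adaptivity

/-! ### The deterministic analysis on the good event. -/

section LabelCount

variable {d : ℕ} {Z : Finset (Fin d → ℝ)} {θs : Fin d → ℝ} {δ ω : ℝ}

/-- The assumptions on the arms and the parameters. -/
structure Admissible (Z : Finset (Fin d → ℝ)) (θs : Fin d → ℝ) (δ ω : ℝ) : Prop where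
  nonempty : Z.Nonempty
  span : Submodule.span ℝ (Z : Set (Fin d → ℝ)) = ⊤
  dot_ne_zero : ∀ z ∈ Z, z ⬝ᵥ θs ≠ 0
  delta_pos : 0 < δ
  delta_lt_one : δ < 1
  omega_pos : 0 < ω
  omega_le_one : ω ≤ 1

namespace Admissible

lemma ne_zero (h : Admissible Z θs δ ω) {z : Fin d → ℝ} (hz : z ∈ Z) : z ≠ 0 := by
  rintro rfl
  exact h.dot_ne_zero 0 hz (zero_dotProduct θs)

lemma d_pos (h : Admissible Z θs δ ω) : 0 < d := by
  obtain ⟨z, hz⟩ := h.nonempty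
  rcases Nat.eq_zero_or_pos d with rfl | hd
  · exact absurd (Subsingleton.elim z 0) (h.ne_zero hz)
  · exact hd

lemma one_le_d (h : Admissible Z θs δ ω) : (1 : ℝ) ≤ d := Nat.one_le_cast.2 h.d_pos

lemma gam_ge (h : Admissible Z θs δ ω) : 320 / 3 * (d : ℝ) ≤ gam Z δ ∧ 64 ≤ gam Z δ := by
  have hc : (0 : ℝ) ≤ Z.card := Nat.cast_nonneg _
  have h1 : 0 ≤ Real.log ((2 + Z.card) / δ) := by
    refine Real.log_nonneg ((one_le_div h.delta_pos).2 ?_)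
    linarith [h.delta_lt_one]
  have h2 := mul_le_mul_of_nonneg_left five_thirds_le_log_six (Nat.cast_nonneg d : (0 : ℝ) ≤ d)
  have h3 := h.one_le_d
  unfold gam
  constructor <;> linarith

lemma gam_pos (h : Admissible Z θs δ ω) : 0 < gam Z δ := lt_of_lt_of_le (by norm_num) h.gam_ge.2

lemma logTerm_ge (h : Admissible Z θs δ ω) {ℓ : ℕ} (hℓ : 1 ≤ ℓ) : 5 / 3 ≤ logTerm Z δ ℓ :=
  five_thirds_le_logTerm h.nonempty h.delta_pos h.delta_lt_one hℓ

lemma logTerm_mono (h : Admissible Z θs δ ω)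
    {ℓ m : ℕ} (hℓ : 1 ≤ ℓ) (hm : ℓ ≤ m) : logTerm Z δ ℓ ≤ logTerm Z δ m := by
  have h6 := six_le_logTerm_arg h.nonempty h.delta_pos h.delta_lt_one hℓ
  have hδ := h.delta_pos
  exact Real.log_le_log (by linarith) (by gcongr)

/-- Up to 4ℓ* rounds may occur. The additional log 16 is at most 10/3, twice the lower bound 5/3 for
the logarithmic term. -/
lemma logTerm_four_mul_le (h : Admissible Z θs δ ω)
    {m : ℕ} (hm : 1 ≤ m) : logTerm Z δ (4 * m) ≤ 3 * logTerm Z δ m := by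
  have h6 := six_le_logTerm_arg h.nonempty h.delta_pos h.delta_lt_one hm
  have h1 := h.logTerm_ge hm
  have e : logTerm Z δ (4 * m) = Real.log 16 + logTerm Z δ m := by
    unfold logTerm
    rw [← Real.log_mul (by norm_num) (by linarith)]
    congr 1
    push_cast
    ring
  have h16 : Real.log 16 ≤ 10 / 3 := by
    rw [show (16 : ℝ) = 2 ^ 4 by norm_num, Real.log_pow]
    have := Real.log_two_lt_d9
    norm_num
    linarith
  linarith

lemma rnum_ge (h : Admissible Z θs δ ω) : (d : ℝ) * (d + 1) + 2 ≤ rnum d ω := by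
  have h1 := h.one_le_d
  rw [rnum, le_div_iff₀ h.omega_pos]
  exact mul_le_of_le_one_right (by positivity) h.omega_le_one

lemma kappa_pos (h : Admissible Z θs δ ω) : 0 < kappa Z θs := by
  have : Nonempty Z := h.nonempty.to_subtype
  obtain ⟨z, hz⟩ := exists_eq_ciInf_of_finite
    (f := fun z : Z => deriv Real.sigmoid ((z : Fin d → ℝ) ⬝ᵥ θs))
  rw [kappa, ← hz]
  exact deriv_sigmoid_pos _

lemma kappa_le {z : Fin d → ℝ} (hz : z ∈ Z) : kappa Z θs ≤ deriv Real.sigmoid (z ⬝ᵥ θs) :=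
  ciInf_le (f := fun z : Z => deriv Real.sigmoid ((z : Fin d → ℝ) ⬝ᵥ θs))
    (Set.finite_range _).bddBelow ⟨z, hz⟩

lemma one_le_inv_kappa (h : Admissible Z θs δ ω) : 1 ≤ (kappa Z θs)⁻¹ := by
  obtain ⟨z, hz⟩ := h.nonempty
  exact (one_le_inv₀ h.kappa_pos).2 ((kappa_le hz).trans (deriv_sigmoid_le_one _))

lemma gap_pos (h : Admissible Z θs δ ω) : 0 < gap Z θs := by
  have : Nonempty Z := h.nonempty.to_subtype
  obtain ⟨z, hz⟩ := exists_eq_ciInf_of_finite (f := fun z : Z => |(z : Fin d → ℝ) ⬝ᵥ θs|)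
  rw [gap, ← hz]
  exact abs_pos.2 (h.dot_ne_zero z z.2)

lemma gap_le {z : Fin d → ℝ} (hz : z ∈ Z) : gap Z θs ≤ |z ⬝ᵥ θs| :=
  ciInf_le (f := fun z : Z => |(z : Fin d → ℝ) ⬝ᵥ θs|) (Set.finite_range _).bddBelow ⟨z, hz⟩

lemma warm_spec (h : Admissible Z θs δ ω) {R : Rules Z} (hR : R.Valid δ) :
    IsOptDesign (warmDesigns Z) (fun l => maxNormSq (gram Z l) Z) R.warm := by
  refine hR.warm ?_
  have := exists_isOptDesign h.nonempty h.span (c := fun _ => 1) (fun _ => one_pos)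
    (continuousOn_maxNormSq Z) one_pos (fun A _ => (one_mul _).le)
  simp only [mul_one] at this
  exact this

lemma design_spec (h : Admissible Z θs δ ω)
    {R : Rules Z} (hR : R.Valid δ) (ℓ : ℕ) (A : Finset (Fin d → ℝ))
    (θ : Fin d → ℝ) : IsOptDesign (designs Z θ) (crit Z δ ℓ A θ) (R.design ℓ A θ) := by
  refine hR.design ℓ A θ ?_
  exact exists_isOptDesign h.nonempty h.span
    (c := fun z => deriv Real.sigmoid ((z : Fin d → ℝ) ⬝ᵥ θ)) (fun _ => deriv_sigmoid_pos _)
    (F := fun M => max (gam Z δ * maxNormSq M Z) (2.4 ^ 2 * (eps ℓ ^ 2)⁻¹ * maxNormSq M A))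
    ((continuousOn_const.mul (continuousOn_maxNormSq Z)).sup
      (continuousOn_const.mul (continuousOn_maxNormSq A)))
    h.gam_pos (fun M _ => le_max_left _ _)

lemma warmPulls_spec (h : Admissible Z θs δ ω) {R : Rules Z} (hR : R.Valid δ) :
    IsEfficientRounding R.warm (N0 Z δ ω θs) (warmPulls R δ ω θs) :=
  hR.round _ _ (exists_isEfficientRounding (h.warm_spec hR).1.1 _)

lemma pulls_spec (h : Admissible Z θs δ ω) {R : Rules Z} (hR : R.Valid δ) (ℓ : ℕ)
    (s : (Fin d → ℝ) × Finset (Fin d → ℝ)) :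
    IsEfficientRounding (R.design ℓ s.2 s.1) (N Z δ ω ℓ s.2 s.1) (pulls R δ ω ℓ s) :=
  hR.round _ _ (exists_isEfficientRounding (h.design_spec hR ℓ s.2 s.1).1.1 _)

lemma two_mul_sparsity_le (d : ℕ) :
    2 * ((d * (d + 1) / 2 + 1 : ℕ) : ℝ) ≤ d * (d + 1) + 2 := by
  have h1 : 2 * (d * (d + 1) / 2 + 1) ≤ d * (d + 1) + 2 := by omega
  exact_mod_cast h1

/-- A sample that is large compared to the support of the design is rounded with little loss. -/
lemma exists_multiplier (h : Admissible Z θs δ ω) {D : Set (Z → ℝ)} {f : (Z → ℝ) → ℝ} {l : Z → ℝ}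
    (hD : D ⊆ stdSimplex ℝ Z) (hl : IsOptDesign D f l) {n : ℕ} {k : Z → ℕ}
    (hk : IsEfficientRounding l n k) (hn : (d : ℝ) * (d + 1) + 2 ≤ n) :
    ∃ ν : ℝ, (n : ℝ) / 2 ≤ ν ∧ 0 < ν ∧ ∀ z, ν * l z ≤ k z := by
  obtain ⟨ν, hν, hνk⟩ := hk.exists_le (hD hl.1)
  have h1 : (({z | l z ≠ 0}.ncard : ℕ) : ℝ) ≤ ((d * (d + 1) / 2 + 1 : ℕ) : ℝ) :=
    Nat.cast_le.2 hl.2.2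
  have h2 := two_mul_sparsity_le d
  have h3 := h.one_le_d
  have h4 : (n : ℝ) / 2 ≤ ν := by linarith
  exact ⟨ν, h4, lt_of_lt_of_le (by nlinarith) h4, hνk⟩

/-- The warm-up is informative. -/
lemma warm_informative (h : Admissible Z θs δ ω) {R : Rules Z} (hR : R.Valid δ) :
    Informative θs (level Z δ 0) (warmPulls R δ ω θs) := by
  have hd := h.one_le_d
  have hT : 5 / 3 ≤ level Z δ 0 := h.logTerm_ge le_rfl
  have hγ := h.gam_ge.1
  have hγ0 := h.gam_pos
  have hκ := h.kappa_pos
  have hκ1 := h.one_le_inv_kappa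
  have hω := h.omega_pos
  set T := level Z δ 0 with hTdef
  set X := (kappa Z θs)⁻¹ * d * gam Z δ * T with hX
  have hN : 3 * X ≤ N0 Z δ ω θs := by
    have e : Real.log (2 * Z.card * (2 + Z.card) / δ) = T := by
      simp [hTdef, level, logTerm]
    refine le_trans ?_ (Nat.le_ceil _)
    rw [e]
    have : 0 ≤ ω * X := by positivity
    nlinarith
  -- This makes N₀ exceed twice the support of the design, although the warm-up has no floor r(ω).
  have hXd : 100 * (d : ℝ) ^ 2 ≤ X := by
    calc 100 * (d : ℝ) ^ 2 ≤ 1 * d * (320 / 3 * d) * (5 / 3) := by nlinarith [sq_nonneg (d : ℝ)]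
      _ ≤ X := by rw [hX]; gcongr
  obtain ⟨ν, hν, hν0, hνk⟩ := h.exists_multiplier (fun _ hl => hl.1) (h.warm_spec hR)
    (h.warmPulls_spec hR) (by nlinarith)
  obtain ⟨l, hl, hld⟩ := exists_design_maxNormSq_le h.nonempty h.d_pos h.span
  have hopt : maxNormSq (gram Z R.warm) Z ≤ d := ((h.warm_spec hR).2.1 hl).trans hld
  have hw : ∀ z : Z, ν * kappa Z θs * R.warm z ≤
      (warmPulls R δ ω θs z : ℝ) * deriv Real.sigmoid ((z : Fin d → ℝ) ⬝ᵥ θs) := fun z => by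
    rw [mul_right_comm]
    exact mul_le_mul (hνk z) (kappa_le z.2) hκ.le (Nat.cast_nonneg _)
  have hc : 0 < ν * kappa Z θs := mul_pos hν0 hκ
  refine ⟨gram_posDef_of_le hc hw (h.warm_spec hR).1.2, fun z hz => ?_⟩
  refine (invNormSq_le_of_le hc (h.warm_spec hR).1.1.1 hw (h.warm_spec hR).1.2 z).trans ?_
  have h1 : 3 / 2 * (d * gam Z δ * T) ≤ ν * kappa Z θs := by
    have e : d * gam Z δ * T = X * kappa Z θs := by rw [hX]; field_simp
    rw [e, ← mul_assoc]
    exact mul_le_mul_of_nonneg_right (by linarith) hκ.le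
  have h2 : 80 * d * T ≤ 3 / 2 * (gam Z δ * T) := by nlinarith
  calc (ν * kappa Z θs)⁻¹ * invNormSq (gram Z R.warm) z
      ≤ (3 / 2 * (d * gam Z δ * T))⁻¹ * d :=
        mul_le_mul (inv_anti₀ (by positivity) h1) ((le_maxNormSq _ hz).trans hopt)
          (invNormSq_nonneg (h.warm_spec hR).1.2 z) (by positivity)
    _ = 1 / (3 / 2 * (gam Z δ * T)) := by field_simp
    _ ≤ 1 / (80 * d * T) := by gcongr

lemma crit_design_le_rho (h : Admissible Z θs δ ω)
    {R : Rules Z} (hR : R.Valid δ) (ℓ : ℕ) (A : Finset (Fin d → ℝ))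
    (θ : Fin d → ℝ) : crit Z δ ℓ A θ (R.design ℓ A θ) ≤ rho Z δ ℓ A θ := by
  have hs := h.design_spec hR ℓ A θ
  have : Nonempty (designs Z θ) := ⟨⟨_, hs.1⟩⟩
  exact le_ciInf fun l => hs.2.1 l.2

lemma eps_pos (ℓ : ℕ) : 0 < eps ℓ := zpow_pos (by norm_num) _

/-- A round that follows a good estimate is informative, in particular about the active arms. -/
lemma round_informative (h : Admissible Z θs δ ω)
    {R : Rules Z} (hR : R.Valid δ) {ℓ : ℕ} (hℓ : 1 ≤ ℓ)
    {s : (Fin d → ℝ) × Finset (Fin d → ℝ)} (hs : ∀ z ∈ Z, |z ⬝ᵥ s.1 - z ⬝ᵥ θs| ≤ 1 / 2) :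
    Informative θs (level Z δ ℓ) (pulls R δ ω ℓ s) ∧ ∀ z ∈ s.2,
      level Z δ ℓ * invNormSq (fisher Z (fun z => (pulls R δ ω ℓ s z : ℝ)) θs) z ≤
        eps ℓ ^ 2 / 4 := by
  have hd := h.one_le_d
  have hlev : level Z δ ℓ = logTerm Z δ ℓ := by rw [level, max_eq_right hℓ]
  have hT : 5 / 3 ≤ level Z δ ℓ := h.logTerm_ge (le_max_left 1 ℓ)
  have hγ := h.gam_ge.1
  have hγ0 := h.gam_pos
  have hω := h.omega_pos
  have hε := eps_pos ℓ
  set T := level Z δ ℓ with hTdef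
  have hopt := h.design_spec hR ℓ s.2 s.1
  set l := R.design ℓ s.2 s.1 with hl
  set ρ := rho Z δ ℓ s.2 s.1 with hρ
  have hcrit : crit Z δ ℓ s.2 s.1 l ≤ ρ := h.crit_design_le_rho hR ℓ s.2 s.1
  have hb1 : ∀ z ∈ Z, gam Z δ * invNormSq (fisher Z l s.1) z ≤ ρ := fun z hz =>
    (mul_le_mul_of_nonneg_left (le_maxNormSq _ hz) hγ0.le).trans ((le_max_left _ _).trans hcrit)
  have hb2 : ∀ z ∈ s.2, 2.4 ^ 2 * (eps ℓ ^ 2)⁻¹ * invNormSq (fisher Z l s.1) z ≤ ρ := fun z hz =>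
    (mul_le_mul_of_nonneg_left (le_maxNormSq _ hz) (by positivity)).trans
      ((le_max_right _ _).trans hcrit)
  have hρ0 : 0 < ρ := by
    obtain ⟨z, hz⟩ := h.nonempty
    exact (mul_pos hγ0 (invNormSq_pos hopt.1.2 (h.ne_zero hz))).trans_le (hb1 z hz)
  have hN1 : 3 * (ρ * T) ≤ N Z δ ω ℓ s.2 s.1 := by
    refine le_trans ?_ (Nat.cast_le.2 (le_max_left _ _))
    refine le_trans ?_ (Nat.le_ceil _)
    rw [← hlev]
    have : 0 ≤ ω * (ρ * T) := by positivity
    nlinarith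
  have hN2 : (d : ℝ) * (d + 1) + 2 ≤ N Z δ ω ℓ s.2 s.1 :=
    h.rnum_ge.trans ((Nat.le_ceil _).trans (Nat.cast_le.2 (le_max_right _ _)))
  obtain ⟨ν, hν, hν0, hνk⟩ := h.exists_multiplier (fun _ hl => hl.1) hopt
    (h.pulls_spec hR ℓ s) hN2
  have hl0 : ∀ z, 0 ≤ l z := hopt.1.1.1
  -- One half is lost here, in passing from the estimate to θ*; another was lost by rounding, as ν ≥
  -- N/2. Hence 3ρT becomes 3/4·ρT below.
  have hw : ∀ z : Z, ν / 2 * (l z * deriv Real.sigmoid ((z : Fin d → ℝ) ⬝ᵥ s.1)) ≤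
      (pulls R δ ω ℓ s z : ℝ) * deriv Real.sigmoid ((z : Fin d → ℝ) ⬝ᵥ θs) := fun z => by
    have h1 := deriv_sigmoid_le_two_mul (s := (z : Fin d → ℝ) ⬝ᵥ θs)
      (t := (z : Fin d → ℝ) ⬝ᵥ s.1) (by rw [abs_sub_comm]; exact hs z z.2)
    calc ν / 2 * (l z * deriv Real.sigmoid ((z : Fin d → ℝ) ⬝ᵥ s.1))
        = ν * l z * (deriv Real.sigmoid ((z : Fin d → ℝ) ⬝ᵥ s.1) / 2) := by ring
      _ ≤ _ := mul_le_mul (hνk z) (by linarith)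
          (div_nonneg (deriv_sigmoid_pos _).le zero_le_two) (Nat.cast_nonneg _)
  have hw0 : ∀ z : Z, 0 ≤ l z * deriv Real.sigmoid ((z : Fin d → ℝ) ⬝ᵥ s.1) := fun z =>
    mul_nonneg (hl0 z) (deriv_sigmoid_pos _).le
  have hinv : ∀ z, invNormSq (fisher Z (fun z => (pulls R δ ω ℓ s z : ℝ)) θs) z ≤
      (3 / 4 * (ρ * T))⁻¹ * invNormSq (fisher Z l s.1) z := fun z => by
    have hq := invNormSq_nonneg hopt.1.2 z
    refine (invNormSq_le_of_le (by positivity) hw0 hw hopt.1.2 z).trans ?_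
    refine mul_le_mul_of_nonneg_right ?_ hq
    gcongr
    linarith
  refine ⟨⟨gram_posDef_of_le (by positivity) hw hopt.1.2, fun z hz => (hinv z).trans ?_⟩,
    fun z hz => ?_⟩
  · have h1 : invNormSq (fisher Z l s.1) z ≤ ρ / gam Z δ := by
      rw [le_div_iff₀ hγ0, mul_comm]; exact hb1 z hz
    have h2 : 80 * d * T ≤ 3 / 4 * (gam Z δ * T) := by nlinarith
    calc (3 / 4 * (ρ * T))⁻¹ * invNormSq (fisher Z l s.1) z
        ≤ (3 / 4 * (ρ * T))⁻¹ * (ρ / gam Z δ) := by gcongr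
      _ = 1 / (3 / 4 * (gam Z δ * T)) := by field_simp
      _ ≤ 1 / (80 * d * T) := by gcongr
  · have h1 : invNormSq (fisher Z l s.1) z ≤ ρ * eps ℓ ^ 2 / 2.4 ^ 2 := by
      have h2 := hb2 z hz
      rw [le_div_iff₀ (by norm_num)]
      have e : invNormSq (fisher Z l s.1) z * 2.4 ^ 2 =
          2.4 ^ 2 * (eps ℓ ^ 2)⁻¹ * invNormSq (fisher Z l s.1) z * eps ℓ ^ 2 := by
        field_simp
      rw [e]
      exact mul_le_mul_of_nonneg_right h2 (by positivity)
    calc T * invNormSq (fisher Z (fun z => (pulls R δ ω ℓ s z : ℝ)) θs) z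
        ≤ T * ((3 / 4 * (ρ * T))⁻¹ * (ρ * eps ℓ ^ 2 / 2.4 ^ 2)) := by
          gcongr
          exact (hinv z).trans (by gcongr)
      _ = eps ℓ ^ 2 * (4 / (3 * 2.4 ^ 2)) := by field_simp
      -- The constant 2.4 is chosen so that 4 / (3 · 2.4²) < 1/4.
      _ ≤ eps ℓ ^ 2 * (1 / 4) := mul_le_mul_of_nonneg_left (by norm_num) (sq_nonneg _)
      _ = _ := by ring

end Admissible

lemma run_snd_subset (R : Rules Z) (δ ω : ℝ) (θs : Fin d → ℝ) (y : ℕ → Z → ℕ → Bool) (ℓ : ℕ) :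
    (run R δ ω θs y ℓ).2 ⊆ Z := by
  induction ℓ with
  | zero => exact subset_rfl
  | succ ℓ ih => exact (Finset.filter_subset _ _).trans ih

/-- The labels are not too noisy in any informative round. -/
def GoodLabels (R : Rules Z) (δ ω : ℝ) (θs : Fin d → ℝ) (y : ℕ → Z → ℕ → Bool) : Prop :=
  ∀ ℓ, Informative θs (level Z δ ℓ) (roundPulls R δ ω θs y ℓ) →
    GoodNoise θs (level Z δ ℓ) (roundPulls R δ ω θs y ℓ)
      (labelled (roundPulls R δ ω θs y ℓ) (y ℓ))

/-! ### Propagation of accuracy, elimination, and counting of labels. -/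

namespace Admissible

lemma run_error_of_informative (h : Admissible Z θs δ ω)
    {R : Rules Z} (hR : R.Valid δ) {y : ℕ → Z → ℕ → Bool} (hy : GoodLabels R δ ω θs y)
    {ℓ : ℕ}
    (hi : Informative θs (level Z δ ℓ) (roundPulls R δ ω θs y ℓ)) {z : Fin d → ℝ} (hz : z ∈ Z) :
    |z ⬝ᵥ (run R δ ω θs y ℓ).1 - z ⬝ᵥ θs| ≤ 1 / 2 ∧
      |z ⬝ᵥ (run R δ ω θs y ℓ).1 - z ⬝ᵥ θs| ≤ 4 * √(level Z δ ℓ *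
        invNormSq (fisher Z (fun z => (roundPulls R δ ω θs y ℓ z : ℝ)) θs) z) := by
  have hT : 0 < level Z δ ℓ :=
    lt_of_lt_of_le (by norm_num) (h.logTerm_ge (le_max_left 1 ℓ))
  rw [run_fst]
  exact (hR.est _ (exists_isMLE h.d_pos hT hi (hy ℓ hi))).error_le h.d_pos hT hi (hy ℓ hi) hz

/-- Each accurate estimate makes the next round informative, hence the next estimate accurate; the
warm-up starts the chain. -/
lemma run_error (h : Admissible Z θs δ ω)
    {R : Rules Z} (hR : R.Valid δ) {y : ℕ → Z → ℕ → Bool} (hy : GoodLabels R δ ω θs y)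
    (ℓ : ℕ) : ∀ z ∈ Z, |z ⬝ᵥ (run R δ ω θs y ℓ).1 - z ⬝ᵥ θs| ≤ 1 / 2 := by
  induction ℓ with
  | zero =>
    exact fun z hz => (h.run_error_of_informative hR hy (ℓ := 0) (h.warm_informative hR) hz).1
  | succ ℓ ih =>
    exact fun z hz => (h.run_error_of_informative hR hy (ℓ := ℓ + 1)
      (h.round_informative hR (Nat.le_add_left 1 ℓ) ih).1 hz).1

lemma run_error_active (h : Admissible Z θs δ ω)
    {R : Rules Z} (hR : R.Valid δ) {y : ℕ → Z → ℕ → Bool} (hy : GoodLabels R δ ω θs y)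
    (ℓ : ℕ) {z : Fin d → ℝ} (hz : z ∈ (run R δ ω θs y ℓ).2) :
    |z ⬝ᵥ (run R δ ω θs y (ℓ + 1)).1 - z ⬝ᵥ θs| ≤ 2 * eps (ℓ + 1) := by
  have hi := h.round_informative hR (Nat.le_add_left 1 ℓ) (h.run_error hR hy ℓ)
  have h1 := (h.run_error_of_informative hR hy (ℓ := ℓ + 1) hi.1
    (run_snd_subset R δ ω θs y ℓ hz)).2
  refine h1.trans ?_
  have hε := eps_pos (ℓ + 1)
  have h2 := Real.sqrt_le_sqrt (hi.2 z hz)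
  rw [show eps (ℓ + 1) ^ 2 / 4 = (eps (ℓ + 1) / 2) ^ 2 by ring, Real.sqrt_sq (by positivity)] at h2
  calc _ ≤ 4 * (eps (ℓ + 1) / 2) := mul_le_mul_of_nonneg_left h2 (by norm_num)
    _ = _ := by ring

lemma abs_dot_le_of_active (h : Admissible Z θs δ ω)
    {R : Rules Z} (hR : R.Valid δ) {y : ℕ → Z → ℕ → Bool} (hy : GoodLabels R δ ω θs y)
    (ℓ : ℕ) {z : Fin d → ℝ} (hz : z ∈ (run R δ ω θs y (ℓ + 1)).2) :
    |z ⬝ᵥ θs| ≤ 3 * eps (ℓ + 1) := by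
  have hz' := Finset.mem_filter.1 hz
  have h1 := h.run_error_active hR hy ℓ hz'.1
  have h2 : |z ⬝ᵥ (run R δ ω θs y (ℓ + 1)).1| ≤ eps (ℓ + 1) := not_lt.1 hz'.2
  have h3 := abs_le.1 h1
  have h4 := abs_le.1 h2
  exact abs_le.2 ⟨by linarith, by linarith⟩

/-- The precision halves each round while ℓ* uses the natural logarithm. The hypothesis gives m log
2 ≤ ℓ*, so m ≤ 2ℓ*, and 2 ≤ 2ℓ* absorbs the shift. -/
lemma le_four_mul_lstar (h : Admissible Z θs δ ω) {m : ℕ} (hm : gap Z θs ≤ 3 * eps (m + 1)) :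
    m + 2 ≤ 4 * lstar Z θs := by
  have hg := h.gap_pos
  have e : eps (m + 1) = ((2 : ℝ) ^ m)⁻¹ := by
    rw [eps, show (1 : ℤ) - ((m + 1 : ℕ) : ℤ) = -(m : ℤ) by push_cast; ring, zpow_neg,
      zpow_natCast]
  have h2 : (2 : ℝ) ^ m ≤ 4 * (gap Z θs)⁻¹ := by
    rw [e, ← div_eq_mul_inv, le_div_iff₀ (by positivity)] at hm
    rw [← div_eq_mul_inv, le_div_iff₀ hg]
    linarith
  have h3 : (m : ℝ) * Real.log 2 ≤ Real.log (4 * (gap Z θs)⁻¹) := by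
    rw [← Real.log_pow]
    exact Real.log_le_log (by positivity) h2
  have h4 : Real.log (4 * (gap Z θs)⁻¹) ≤ lstar Z θs :=
    (Nat.le_ceil _).trans (Nat.cast_le.2 (le_max_right _ _))
  have h5 : (m : ℝ) ≤ (2 * lstar Z θs : ℕ) := by
    push_cast
    nlinarith [Real.log_two_gt_d9, (Nat.cast_nonneg m : (0 : ℝ) ≤ m)]
  have h6 : m ≤ 2 * lstar Z θs := Nat.cast_le.1 h5
  have h7 : 1 ≤ lstar Z θs := le_max_left _ _
  omega

lemma exists_endsAfter (h : Admissible Z θs δ ω)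
    {R : Rules Z} (hR : R.Valid δ) {y : ℕ → Z → ℕ → Bool} (hy : GoodLabels R δ ω θs y)
    : ∃ L, EndsAfter R δ ω θs y L ∧ L ≤ 4 * lstar Z θs := by
  have hbound : ∀ m, (run R δ ω θs y (m + 1)).2.Nonempty → m + 2 ≤ 4 * lstar Z θs := by
    rintro m ⟨z, hz⟩
    exact h.le_four_mul_lstar ((gap_le (run_snd_subset R δ ω θs y (m + 1) hz)).trans
      (h.abs_dot_le_of_active hR hy m hz))
  have hex : ∃ L, (run R δ ω θs y L).2 = ∅ := by
    refine ⟨4 * lstar Z θs + 1, ?_⟩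
    rw [← Finset.not_nonempty_iff_eq_empty]
    intro hne
    have := hbound _ hne
    omega
  classical
  refine ⟨Nat.find hex, ⟨Nat.find_spec hex, fun m hm => Nat.find_min hex hm⟩, ?_⟩
  have hl : 1 ≤ lstar Z θs := le_max_left _ _
  rcases Nat.lt_or_ge (Nat.find hex) 2 with h2 | h2
  · omega
  · obtain ⟨m, hm⟩ := Nat.exists_eq_add_of_le' h2
    have := hbound m (Finset.nonempty_iff_ne_empty.2 (Nat.find_min hex (by omega)))
    omega

lemma nonempty_designs (h : Admissible Z θs δ ω) (θ : Fin d → ℝ) : Nonempty (designs Z θ) := by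
  obtain ⟨l, hl, hpos⟩ := exists_mem_stdSimplex_pos h.nonempty
  exact ⟨⟨l, hl, gram_posDef_of_pos h.span fun z => mul_pos (hpos z) (deriv_sigmoid_pos _)⟩⟩

lemma crit_nonneg (h : Admissible Z θs δ ω)
    (ℓ : ℕ) (A : Finset (Fin d → ℝ)) {θ : Fin d → ℝ} {l : Z → ℝ}
    (hl : l ∈ designs Z θ) : 0 ≤ crit Z δ ℓ A θ l :=
  (mul_nonneg h.gam_pos.le (maxNormSq_nonneg hl.2 Z)).trans (le_max_left _ _)

/-- Mixing a design for `ρ*` with one for `ρ₀` gives a design for round `ℓ`. -/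
lemma rho_le_of_designs (h : Admissible Z θs δ ω)
    {ℓ : ℕ} {A : Finset (Fin d → ℝ)} {θ : Fin d → ℝ} (hA : A ⊆ Z)
    (hθ : ∀ z ∈ Z, |z ⬝ᵥ θ - z ⬝ᵥ θs| ≤ 1 / 2)
    (hact : ∀ z ∈ A, 1 ≤ eps ℓ ∨ |z ⬝ᵥ θs| ≤ 6 * eps ℓ) {l₁ l₂ : Z → ℝ}
    (hl₁ : l₁ ∈ designs Z θs) (hl₂ : l₂ ∈ designs Z θs) :
    rho Z δ ℓ A θ ≤ 830 * (⨆ z : Z, invNormSq (fisher Z l₁ θs) z / |(z : Fin d → ℝ) ⬝ᵥ θs| ^ 2) +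
      2 * ⨆ z : Z, 3 * gam Z δ * invNormSq (fisher Z l₂ θs) z := by
  have hγ := h.gam_ge.2
  have hγ0 := h.gam_pos
  have hε := eps_pos ℓ
  set f₁ := ⨆ z : Z, invNormSq (fisher Z l₁ θs) z / |(z : Fin d → ℝ) ⬝ᵥ θs| ^ 2 with hf₁
  set f₂ := ⨆ z : Z, 3 * gam Z δ * invNormSq (fisher Z l₂ θs) z with hf₂
  have hb₁ : ∀ z ∈ Z, invNormSq (fisher Z l₁ θs) z / |z ⬝ᵥ θs| ^ 2 ≤ f₁ := fun z hz =>
    le_ciSup (f := fun z : Z => invNormSq (fisher Z l₁ θs) z / |(z : Fin d → ℝ) ⬝ᵥ θs| ^ 2)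
      (Set.finite_range _).bddAbove ⟨z, hz⟩
  have hb₂ : ∀ z ∈ Z, 3 * gam Z δ * invNormSq (fisher Z l₂ θs) z ≤ f₂ := fun z hz =>
    le_ciSup (f := fun z : Z => 3 * gam Z δ * invNormSq (fisher Z l₂ θs) z)
      (Set.finite_range _).bddAbove ⟨z, hz⟩
  have hf₁0 : 0 ≤ f₁ := Real.iSup_nonneg fun z =>
    div_nonneg (invNormSq_nonneg hl₁.2 _) (sq_nonneg _)
  have hf₂0 : 0 ≤ f₂ := Real.iSup_nonneg fun z =>
    mul_nonneg (by positivity) (invNormSq_nonneg hl₂.2 _)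
  set l : Z → ℝ := (1 / 2 : ℝ) • l₁ + (1 / 2 : ℝ) • l₂ with hl
  have hlmem : l ∈ stdSimplex ℝ Z :=
    convex_stdSimplex ℝ Z hl₁.1 hl₂.1 (by norm_num) (by norm_num) (by norm_num)
  -- The mixture costs 1/2, and passing from θ* to the estimate another 1/2.
  have hw : ∀ l' : Z → ℝ, (∀ z, 0 ≤ l' z) → (∀ z, l' z / 2 ≤ l z) → ∀ z : Z,
      1 / 4 * (l' z * deriv Real.sigmoid ((z : Fin d → ℝ) ⬝ᵥ θs)) ≤
        l z * deriv Real.sigmoid ((z : Fin d → ℝ) ⬝ᵥ θ) := by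
    intro l' h0 h1 z
    have h2 := deriv_sigmoid_le_two_mul (hθ z z.2)
    calc 1 / 4 * (l' z * deriv Real.sigmoid ((z : Fin d → ℝ) ⬝ᵥ θs))
        = l' z / 2 * (deriv Real.sigmoid ((z : Fin d → ℝ) ⬝ᵥ θs) / 2) := by ring
      _ ≤ _ := mul_le_mul (h1 z) (by linarith)
          (div_nonneg (deriv_sigmoid_pos _).le zero_le_two) (hlmem.1 z)
  have hw₁ := hw l₁ hl₁.1.1 fun z => by
    have := hl₂.1.1 z
    simp only [hl, Pi.add_apply, Pi.smul_apply, smul_eq_mul]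
    linarith
  have hw₂ := hw l₂ hl₂.1.1 fun z => by
    have := hl₁.1.1 z
    simp only [hl, Pi.add_apply, Pi.smul_apply, smul_eq_mul]
    linarith
  have hP : (fisher Z l θ).PosDef := gram_posDef_of_le (by norm_num) hw₁ hl₁.2
  have hwn : ∀ l' : Z → ℝ, (∀ z, 0 ≤ l' z) → ∀ z : Z,
      0 ≤ l' z * deriv Real.sigmoid ((z : Fin d → ℝ) ⬝ᵥ θs) := fun l' h0 z =>
    mul_nonneg (h0 z) (deriv_sigmoid_pos _).le
  have hi₁ : ∀ z, invNormSq (fisher Z l θ) z ≤ 4 * invNormSq (fisher Z l₁ θs) z := fun z => by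
    have := invNormSq_le_of_le (by norm_num) (hwn l₁ hl₁.1.1) hw₁ hl₁.2 z
    norm_num at this
    exact this
  have hi₂ : ∀ z, invNormSq (fisher Z l θ) z ≤ 4 * invNormSq (fisher Z l₂ θs) z := fun z => by
    have := invNormSq_le_of_le (by norm_num) (hwn l₂ hl₂.1.1) hw₂ hl₂.2 z
    norm_num at this
    exact this
  refine (ciInf_le (f := fun l : designs Z θ => crit Z δ ℓ A θ l)
    ⟨0, by rintro _ ⟨l, rfl⟩; exact h.crit_nonneg ℓ A l.2⟩ ⟨l, hlmem, hP⟩).trans ?_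
  refine max_le ?_ ?_
  · rw [mul_comm, ← le_div_iff₀ hγ0]
    refine maxNormSq_le (by positivity) fun z hz => ?_
    rw [le_div_iff₀ hγ0]
    have h1 := mul_le_mul_of_nonneg_right (hi₂ z) hγ0.le
    have h2 := hb₂ z hz
    linarith
  · rw [mul_comm, ← le_div_iff₀ (by positivity)]
    refine maxNormSq_le (by positivity) fun z hz => ?_
    rw [le_div_iff₀ (by positivity), mul_comm]
    -- In the first round no arm has been tested, so ρ₀ must cover the second criterion, which is
    -- possible since ε ≥ 1 and γ(d) ≥ 64. Otherwise ρ* covers it, with 2.4² · 36 · 4 < 830.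
    rcases hact z hz with h1 | h1
    · have h2 := hb₂ z (hA hz)
      have h3 : (eps ℓ ^ 2)⁻¹ ≤ 1 := inv_le_one_of_one_le₀ (one_le_pow₀ h1)
      have hq := invNormSq_nonneg hl₂.2 z
      have h4 : 64 * invNormSq (fisher Z l₂ θs) z ≤ gam Z δ * invNormSq (fisher Z l₂ θs) z :=
        mul_le_mul_of_nonneg_right hγ hq
      calc 2.4 ^ 2 * (eps ℓ ^ 2)⁻¹ * invNormSq (fisher Z l θ) z
          ≤ 2.4 ^ 2 * 1 * (4 * invNormSq (fisher Z l₂ θs) z) :=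
            mul_le_mul (by gcongr) (hi₂ z) (invNormSq_nonneg hP z) (by norm_num)
        _ ≤ _ := by linarith
    · have h2 := hb₁ z (hA hz)
      have hz0 : 0 < |z ⬝ᵥ θs| := abs_pos.2 (h.dot_ne_zero z (hA hz))
      have hq := invNormSq_nonneg hl₁.2 z
      have h3 : (eps ℓ ^ 2)⁻¹ ≤ 36 / |z ⬝ᵥ θs| ^ 2 := by
        rw [inv_eq_one_div, div_le_div_iff₀ (by positivity) (by positivity)]
        nlinarith
      calc 2.4 ^ 2 * (eps ℓ ^ 2)⁻¹ * invNormSq (fisher Z l θ) z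
          ≤ 2.4 ^ 2 * (36 / |z ⬝ᵥ θs| ^ 2) * (4 * invNormSq (fisher Z l₁ θs) z) :=
            mul_le_mul (by gcongr) (hi₁ z) (invNormSq_nonneg hP z) (by positivity)
        _ = 2.4 ^ 2 * 36 * 4 * (invNormSq (fisher Z l₁ θs) z / |z ⬝ᵥ θs| ^ 2) := by ring
        _ ≤ _ := by nlinarith

/-- The two designs in the mixture are independent of each other, so the infima may be taken one
after the other; neither need be attained. -/
lemma rho_le (h : Admissible Z θs δ ω) {ℓ : ℕ} {A : Finset (Fin d → ℝ)} {θ : Fin d → ℝ} (hA : A ⊆ Z)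
    (hθ : ∀ z ∈ Z, |z ⬝ᵥ θ - z ⬝ᵥ θs| ≤ 1 / 2)
    (hact : ∀ z ∈ A, 1 ≤ eps ℓ ∨ |z ⬝ᵥ θs| ≤ 6 * eps ℓ) :
    rho Z δ ℓ A θ ≤ 830 * rhoStar Z θs + 2 * rhoZero Z δ θs := by
  have := h.nonempty_designs θs
  have h1 : ∀ l₂ : designs Z θs,
      (rho Z δ ℓ A θ - 2 * ⨆ z : Z, 3 * gam Z δ * invNormSq (fisher Z l₂ θs) z) / 830 ≤
        rhoStar Z θs := fun l₂ => le_ciInf fun l₁ => by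
    have := h.rho_le_of_designs hA hθ hact l₁.2 l₂.2
    linarith
  have h2 : (rho Z δ ℓ A θ - 830 * rhoStar Z θs) / 2 ≤ rhoZero Z δ θs := le_ciInf fun l₂ => by
    have := h1 l₂
    linarith
  linarith

lemma sum_pulls_le (h : Admissible Z θs δ ω)
    {R : Rules Z} (hR : R.Valid δ) {y : ℕ → Z → ℕ → Bool} (hy : GoodLabels R δ ω θs y)
    {ℓ : ℕ} (hℓ : ℓ + 1 ≤ 4 * lstar Z θs) :
    (∑ z, pulls R δ ω (ℓ + 1) (run R δ ω θs y ℓ) z : ℕ) ≤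
      9 * (1 + ω) * logTerm Z δ (lstar Z θs) * (830 * rhoStar Z θs + 2 * rhoZero Z δ θs) +
        2 * rnum d ω := by
  have hl : 1 ≤ lstar Z θs := le_max_left _ _
  have hω := h.omega_pos
  rw [(h.pulls_spec hR (ℓ + 1) (run R δ ω θs y ℓ)).2.1]
  set s := run R δ ω θs y ℓ with hs
  -- An active arm of a later round survived the previous one, whose precision is twice as coarse:
  -- 3ε_ℓ = 6ε_{ℓ+1}.
  have hact : ∀ z ∈ s.2, 1 ≤ eps (ℓ + 1) ∨ |z ⬝ᵥ θs| ≤ 6 * eps (ℓ + 1) := by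
    intro z hz
    cases ℓ with
    | zero => left; simp [eps]
    | succ ℓ =>
      right
      have h1 := h.abs_dot_le_of_active hR hy ℓ hz
      have h2 : eps (ℓ + 1) = 2 * eps (ℓ + 1 + 1) := by
        rw [eps, eps, ← zpow_one_add₀ (by norm_num)]
        congr 1
      linarith
  have hρ := h.rho_le (run_snd_subset R δ ω θs y ℓ) (h.run_error hR hy ℓ) hact
  rw [← hs] at hρ
  have hρ0 : 0 ≤ rho Z δ (ℓ + 1) s.2 s.1 :=
    Real.iInf_nonneg fun l => h.crit_nonneg (ℓ + 1) s.2 l.2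
  have hT0 := h.logTerm_ge (Nat.le_add_left 1 ℓ)
  have hT : logTerm Z δ (ℓ + 1) ≤ 3 * logTerm Z δ (lstar Z θs) :=
    (h.logTerm_mono (Nat.le_add_left 1 ℓ) hℓ).trans (h.logTerm_four_mul_le hl)
  have hr := h.rnum_ge
  have hd := h.one_le_d
  have h1 : (N Z δ ω (ℓ + 1) s.2 s.1 : ℝ) ≤
      3 * (1 + ω) * rho Z δ (ℓ + 1) s.2 s.1 * logTerm Z δ (ℓ + 1) + 1 + (rnum d ω + 1) := by
    have e1 := Nat.ceil_lt_add_one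
      (a := 3 * (1 + ω) * rho Z δ (ℓ + 1) s.2 s.1 * logTerm Z δ (ℓ + 1)) (by positivity)
    have e2 := Nat.ceil_lt_add_one (a := rnum d ω) (by nlinarith)
    rw [N, Nat.cast_max]
    refine max_le ?_ ?_
    · nlinarith
    · have : 0 ≤ 3 * (1 + ω) * rho Z δ (ℓ + 1) s.2 s.1 * logTerm Z δ (ℓ + 1) := by positivity
      linarith
  have h2 : 3 * (1 + ω) * rho Z δ (ℓ + 1) s.2 s.1 * logTerm Z δ (ℓ + 1) ≤
      3 * (1 + ω) * (830 * rhoStar Z θs + 2 * rhoZero Z δ θs) *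
        (3 * logTerm Z δ (lstar Z θs)) := by
    have := hρ0.trans hρ
    gcongr
  -- The two units lost to the ceilings are absorbed by the second r(ω), which is at least 2.
  nlinarith

lemma sum_warmPulls_le (h : Admissible Z θs δ ω) {R : Rules Z} (hR : R.Valid δ) :
    (∑ z, warmPulls R δ ω θs z : ℕ) ≤
      4 * (1 + ω) * (kappa Z θs)⁻¹ * d * gam Z δ * logTerm Z δ (lstar Z θs) := by
  have hd := h.one_le_d
  have hω := h.omega_pos
  have hκ := h.one_le_inv_kappa
  have hγ := h.gam_ge.2
  have hT1 := h.logTerm_ge le_rfl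
  have hl : 1 ≤ lstar Z θs := le_max_left _ _
  have hT := h.logTerm_mono le_rfl hl
  have hκ0 := h.kappa_pos
  have hγ0 := h.gam_pos
  have e : Real.log (2 * Z.card * (2 + Z.card) / δ) = logTerm Z δ 1 := by simp [logTerm]
  rw [(h.warmPulls_spec hR).2.1, N0, e]
  set X := (1 + ω) * (kappa Z θs)⁻¹ * d * gam Z δ * logTerm Z δ 1 with hX
  have hX1 : 1 ≤ X := by
    calc (1 : ℝ) ≤ (1 + 0) * 1 * 1 * 64 * (5 / 3) := by norm_num
      _ ≤ X := by rw [hX]; gcongr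
  have e2 : 3 * (1 + ω) * (kappa Z θs)⁻¹ * d * gam Z δ * logTerm Z δ 1 = 3 * X := by
    rw [hX]; ring
  rw [e2]
  calc (⌈3 * X⌉₊ : ℝ) ≤ 3 * X + 1 := (Nat.ceil_lt_add_one (by linarith)).le
    _ ≤ 4 * X := by linarith
    _ = 4 * (1 + ω) * (kappa Z θs)⁻¹ * d * gam Z δ * logTerm Z δ 1 := by rw [hX]; ring
    _ ≤ _ := by gcongr

lemma totalLabels_le (h : Admissible Z θs δ ω)
    {R : Rules Z} (hR : R.Valid δ) {y : ℕ → Z → ℕ → Bool} (hy : GoodLabels R δ ω θs y)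
    {L : ℕ} (hL : L ≤ 4 * lstar Z θs) :
    (totalLabels R δ ω θs y L : ℝ) ≤
      60000 * (1 + ω) * lstar Z θs * logTerm Z δ (lstar Z θs) * rhoStar Z θs
        + 60000 * (1 + ω) * lstar Z θs * logTerm Z δ (lstar Z θs) * rhoZero Z δ θs
        + 60000 * (1 + ω) * (kappa Z θs)⁻¹ * d * gam Z δ * logTerm Z δ (lstar Z θs)
        + 60000 * lstar Z θs * rnum d ω := by
  have hl : 1 ≤ lstar Z θs := le_max_left _ _
  have hω := h.omega_pos
  have hT := h.logTerm_ge hl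
  have hκ0 := h.kappa_pos
  have hγ0 := h.gam_pos
  have hr : 0 ≤ rnum d ω := by
    have := h.rnum_ge
    have hd := h.one_le_d
    nlinarith
  have hs0 : 0 ≤ rhoStar Z θs := Real.iInf_nonneg fun l => Real.iSup_nonneg fun z =>
    div_nonneg (invNormSq_nonneg l.2.2 _) (sq_nonneg _)
  have hz0 : 0 ≤ rhoZero Z δ θs := Real.iInf_nonneg fun l => Real.iSup_nonneg fun z =>
    mul_nonneg (by positivity) (invNormSq_nonneg l.2.2 _)
  have hwarm := h.sum_warmPulls_le hR
  set B := 9 * (1 + ω) * logTerm Z δ (lstar Z θs) * (830 * rhoStar Z θs + 2 * rhoZero Z δ θs) +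
    2 * rnum d ω with hB
  have hB0 : 0 ≤ B := by positivity
  have hmain : (mainLabels R δ ω θs y L : ℝ) ≤ 4 * lstar Z θs * B := by
    rw [mainLabels, Nat.cast_sum]
    refine (Finset.sum_le_sum fun ℓ hℓ => h.sum_pulls_le hR hy
      ((Finset.mem_range.1 hℓ).trans_le hL)).trans ?_
    rw [Finset.sum_const, Finset.card_range, nsmul_eq_mul]
    refine mul_le_mul_of_nonneg_right ?_ hB0
    exact_mod_cast hL
  have e : (totalLabels R δ ω θs y L : ℝ) = (∑ z, warmPulls R δ ω θs z : ℕ) +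
      mainLabels R δ ω θs y L + mainLabels R δ ω θs y L := by
    rw [totalLabels]; push_cast; ring
  rw [e]
  set U := (lstar Z θs : ℝ) * ((1 + ω) * logTerm Z δ (lstar Z θs) * rhoStar Z θs) with hU
  set V := (lstar Z θs : ℝ) * ((1 + ω) * logTerm Z δ (lstar Z θs) * rhoZero Z δ θs) with hV
  set W := (1 + ω) * (kappa Z θs)⁻¹ * d * gam Z δ * logTerm Z δ (lstar Z θs) with hW
  set X := (lstar Z θs : ℝ) * rnum d ω with hX
  have hU0 : 0 ≤ U := by positivity
  have hV0 : 0 ≤ V := by positivity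
  have hW0 : 0 ≤ W := by positivity
  have hX0 : 0 ≤ X := by positivity
  have e1 : 4 * lstar Z θs * B = 4 * (7470 * U + 18 * V + 2 * X) := by
    rw [hB, hU, hV, hX]; ring
  have e2 : 4 * (1 + ω) * (kappa Z θs)⁻¹ * d * gam Z δ * logTerm Z δ (lstar Z θs) = 4 * W := by
    rw [hW]; ring
  -- The sum of the rounds is counted twice because of the final phase; 8 · 7470 = 59760 determines
  -- the constant.
  calc _ ≤ 4 * W + 4 * (7470 * U + 18 * V + 2 * X) + 4 * (7470 * U + 18 * V + 2 * X) := by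
        linarith
    _ ≤ 60000 * U + 60000 * V + 60000 * W + 60000 * X := by linarith
    _ = _ := by rw [hU, hV, hW, hX]; ring

end Admissible

end LabelCount

end PrefDesign

theorem theorem2 :
    ∃ c : ℝ, 0 < c ∧
      ∀ (d : ℕ) (Z : Finset (Fin d → ℝ)) (θstar : Fin d → ℝ) (δ ω : ℝ)
        (R : PrefDesign.Rules Z)
        (Ω : Type*) [MeasurableSpace Ω] (P : Measure Ω) [IsProbabilityMeasure P]
        (Y : ℕ → Z → ℕ → Ω → Bool),
        Z.Nonempty →
        (∀ z ∈ Z, ‖WithLp.toLp 2 z‖ ≤ 1) →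
        Submodule.span ℝ (Z : Set (Fin d → ℝ)) = ⊤ →
        (∀ z ∈ Z, z ⬝ᵥ θstar ≠ 0) →
        0 < δ → δ < 1 → 0 < ω → ω ≤ 1 →
        R.Valid δ →
        PrefDesign.IsLabelTable P θstar Y →
        ENNReal.ofReal (1 - δ) ≤
          P {x | ∃ L : ℕ, PrefDesign.EndsAfter R δ ω θstar (fun ℓ z j => Y ℓ z j x) L ∧
            (PrefDesign.totalLabels R δ ω θstar (fun ℓ z j => Y ℓ z j x) L : ℝ) ≤
              c * (1 + ω) * PrefDesign.lstar Z θstar *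
                  PrefDesign.logTerm Z δ (PrefDesign.lstar Z θstar) *
                  PrefDesign.rhoStar Z θstar
                + c * (1 + ω) * PrefDesign.lstar Z θstar *
                  PrefDesign.logTerm Z δ (PrefDesign.lstar Z θstar) *
                  PrefDesign.rhoZero Z δ θstar
                + c * (1 + ω) * (PrefDesign.kappa Z θstar)⁻¹ * d * PrefDesign.gam Z δ *
                  PrefDesign.logTerm Z δ (PrefDesign.lstar Z θstar)
                + c * PrefDesign.lstar Z θstar * PrefDesign.rnum d ω} := by
  refine ⟨60000, by norm_num, ?_⟩
  intro d Z θstar δ ω R Ω _ P _ Y hZ _ hspan hne hδ0 hδ1 hω0 hω1 hR hY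
  have h : PrefDesign.Admissible Z θstar δ ω := ⟨hZ, hspan, hne, hδ0, hδ1, hω0, hω1⟩
  refine (PrefDesign.measure_goodNoise_ge (ω := ω) hY h.d_pos hZ (fun z hz => h.ne_zero hz) hδ0 hδ1
    R).trans (measure_mono fun x hx => ?_)
  obtain ⟨L, hL, hLle⟩ := h.exists_endsAfter hR (y := fun ℓ z j => Y ℓ z j x) hx
  exact ⟨L, hL, h.totalLabels_le hR hx hLle⟩
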